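/- Let $p$ be a prime, let $\mathbb{Q}_p$ be the field of $p$-adic numbers with absolute value $|\cdot|_p$, and let $\chi(x)=\exp(2\pi i\{x\}_p)$ be its canonical additive character, where $\{x\}_p$ is the $p$-adic fractional part of $x$. The characteristic function of a probability measure $\mu$ on the Borel sets of $\mathbb{Q}_p$ is $\widehat\mu(t)=\int_{\mathbb{Q}_p}\chi(tx)\,\mu(dx)$. For a sequence $X_1,X_2,\dots$ of independent identically distributed $\mathbb{Q}_p$-valued random variables, nonzero $B_n\in\mathbb{Q}_p$ and an increasing sequence $k(n)$ of positive integers, put $$S_n=B_n^{-1}\bigl(X_1+\cdots+X_{k(n)}\bigr),\qquad \rho_n=\frac{k(n)}{k(n+1)},\qquad \gamma_n=\frac{B_n}{B_{n+1}},$$ and let $F_n$ be the distribution of $S_n$. Let $0<\beta<1$ and $\gamma_0\in\mathbb{Q}_p$ with $0\neq|\gamma_0|_p\le p^{-1}$. By a Lévy measure we mean a Borel measure $\Phi$ on $\mathbb{Q}_p\setminus\{0\}$ that is finite outside any neighbourhood of zero. Consider the conditions $$\Phi(M)=\beta\,\Phi(\gamma_0M)\quad\text{for every compact open } M\subset\mathbb{Q}_p\setminus\{0\},\tag{1}$$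 $$g(t)=\exp\int_{\mathbb{Q}_p\setminus\{0\}}\bigl(\chi(ty)-1\bigr)\,\Phi(dy),\qquad t\in\mathbb{Q}_p.\tag{2}$$ (i) If $\Phi$ is a Lévy measure satisfying (1), then the function $g$ given by (2) is the characteristic function of a probability distribution on $\mathbb{Q}_p$ that is the weak limit of the distributions $F_n$ for some choice of $(X_n)$, $(B_n)$, $(k(n))$ as above with $\rho_n\to\beta$ and $\gamma_n\to\gamma_0$. (ii) Conversely, suppose that the $X_n$ have a symmetric distribution (that is, $\mathbf{P}(X_n\in -M)=\mathbf{P}(X_n\in M)$ for all Borel $M$), that $|B_n|_p\to\infty$, $\gamma_n\to\gamma_0$, $\rho_n\to\beta$, and that $F_n$ converges weakly to a probability distribution $G$. Then the characteristic function of $G$ has the form (2), where $\Phi$ is a Lévy measure that is symmetric ($\Phi(-M)=\Phi(M)$ for all Borel $M$) and satisfies (1). -/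

import Mathlib

open MeasureTheory ProbabilityTheory Filter Topology
open scoped Pointwise

noncomputable section

namespace PadicLimit

variable {p : ℕ} [Fact p.Prime]

/-- The number of digits of `x` before the "p-adic point": it is `N` if `‖x‖ = p ^ N` with `N > 0`,
and `0` if `‖x‖ ≤ 1`. -/
def fractLength (x : ℚ_[p]) : ℕ := (-x.valuation).toNat

theorem norm_pow_fractLength_mul_le (x : ℚ_[p]) :
    ‖(p : ℚ_[p]) ^ fractLength x * x‖ ≤ 1 := by
  by_cases hx : x = 0
  · simp [hx]
  have hp : (1 : ℝ) < p := by exact_mod_cast (Fact.out : p.Prime).one_lt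
  rw [norm_mul, norm_pow, Padic.norm_p, Padic.norm_eq_zpow_neg_valuation hx, inv_pow,
    ← zpow_natCast, ← zpow_neg, ← zpow_add₀ (by positivity)]
  refine zpow_le_one_of_nonpos₀ hp.le ?_
  have := Int.self_le_toNat (-x.valuation)
  unfold fractLength
  omega

/-- The fractional part `{x}_p`. If `‖x‖ = p ^ N` with `N > 0` and
`x = p ^ (-N) * (x₀ + x₁ p + x₂ p ^ 2 + ⋯)` with digits `0 ≤ xᵢ < p`, it is
`p ^ (-N) * (x₀ + x₁ p + ⋯ + x_{N-1} p ^ (N-1))`; it is `0` if `‖x‖ ≤ 1`.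
(`PadicInt.appr z N` is the truncation of the digit expansion of `z` modulo `p ^ N`.) -/
def fract (x : ℚ_[p]) : ℝ :=
  (PadicInt.appr ⟨(p : ℚ_[p]) ^ fractLength x * x, norm_pow_fractLength_mul_le x⟩
    (fractLength x) : ℝ) / (p : ℝ) ^ fractLength x

/-- The canonical additive character `χ(x) = exp(2πi {x}_p)` of `ℚ_p`. -/
def chi (x : ℚ_[p]) : ℂ := Complex.exp (2 * Real.pi * Complex.I * (fract x : ℂ))

/-- The characteristic function `t ↦ ∫ χ(tx) μ(dx)` of a measure on `ℚ_p`. -/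
def charFn [MeasurableSpace ℚ_[p]] (μ : Measure ℚ_[p]) (t : ℚ_[p]) : ℂ :=
  ∫ x, chi (t * x) ∂μ

/-- A Borel measure on `ℚ_p ∖ {0}`, regarded as a measure on `ℚ_p` that does not charge `0`,
which is finite outside any neighbourhood of zero. -/
structure IsLevyMeasure [MeasurableSpace ℚ_[p]] (Φ : Measure ℚ_[p]) : Prop where
  zero_null : Φ {0} = 0
  finite_compl : ∀ U ∈ 𝓝 (0 : ℚ_[p]), Φ Uᶜ < ⊤

/-- The functional equation `Φ(M) = β Φ(γ₀ M)` for all compact open `M ⊆ ℚ_p ∖ {0}`. -/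
def ScalingRelation [MeasurableSpace ℚ_[p]] (Φ : Measure ℚ_[p]) (β : ℝ) (γ₀ : ℚ_[p]) : Prop :=
  ∀ M : Set ℚ_[p], IsCompact M → IsOpen M → (0 : ℚ_[p]) ∉ M →
    Φ M = ENNReal.ofReal β * Φ (γ₀ • M)

/-- `exp ∫_{ℚ_p ∖ {0}} (χ(ty) - 1) Φ(dy)`. -/
def levyExp [MeasurableSpace ℚ_[p]] (Φ : Measure ℚ_[p]) (t : ℚ_[p]) : ℂ :=
  Complex.exp (∫ y in {0}ᶜ, (chi (t * y) - 1) ∂Φ)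

/-- A measure is symmetric if `μ(-M) = μ(M)` for all Borel sets `M`. -/
def IsSymm [MeasurableSpace ℚ_[p]] (μ : Measure ℚ_[p]) : Prop :=
  ∀ M : Set ℚ_[p], MeasurableSet M → μ (-M) = μ M

/-- Independent identically distributed `ℚ_p`-valued random variables. -/
structure IsIID [MeasurableSpace ℚ_[p]] {Ω : Type*} [MeasurableSpace Ω] (P : Measure Ω)
    (X : ℕ → Ω → ℚ_[p]) : Prop where
  measurable : ∀ i, Measurable (X i)
  indep : iIndepFun X P
  ident : ∀ i j, IdentDistrib (X i) (X j) P P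

/-- The normalized sum of the first `k n` variables, `B_n⁻¹ (X_1 + ⋯ + X_{k(n)})`. -/
def normalizedSum {Ω : Type*} (X : ℕ → Ω → ℚ_[p]) (B : ℕ → ℚ_[p]) (k : ℕ → ℕ) (n : ℕ) (ω : Ω) :
    ℚ_[p] :=
  (B n)⁻¹ * ∑ i ∈ Finset.range (k n), X i ω

/-- The distributions `F_n` of the normalized sums converge weakly to the distribution `G`. -/
def SumsConvergeTo [MeasurableSpace ℚ_[p]] [BorelSpace ℚ_[p]] {Ω : Type*} [MeasurableSpace Ω]
    (P : Measure Ω) [IsProbabilityMeasure P] (X : ℕ → Ω → ℚ_[p]) (B : ℕ → ℚ_[p]) (k : ℕ → ℕ)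
    (G : Measure ℚ_[p]) [IsProbabilityMeasure G] : Prop :=
  TendstoInDistribution (normalizedSum X B k) atTop (id : ℚ_[p] → ℚ_[p]) (fun _ => P) G

end PadicLimit

end

/-
For a measure `ν` with finite mass off every neighbourhood of zero write
`E(t) = ∫ (χ(ty) - 1) ν(dy)`. Averaging over the unit ball of `ℚ_p` and using orthogonality of
characters, the part of `ν` outside the ball `‖c y‖ ≤ 1` has characteristic function
`s ↦ ∫_{‖u‖ ≤ 1} (E(s) - E(s + c u)) du`. This formula gives uniqueness of `ν` off zero,
tightness in Lévy's continuity theorem, and a Lévy–Khintchine limit theorem: if the exponents `E_n`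
of finite measures `ν_n` converge to a continuous function `L`, then outside each ball the `ν_n`
converge, and the limits glue to a Lévy measure with exponent `L`.

In (i), the scaling relation says `E(tγ₀) = β E(t)`, so that i.i.d. variables with law `exp E`,
summed with `k(n) ∼ β⁻ⁿ` and `B_n = γ₀⁻ⁿ`, have normalized sums tending to `exp E`.

In (ii), symmetry makes the characteristic function `g` of `G` nonnegative after one normalization
step, and comparing the normalizations `n` and `n + 1` gives `g(tγ₀) = g(t)^β`. Hence `g > 0`, and
`β⁻ⁿ (g(tγ₀ⁿ) - 1) → log g(t)`: here the left side is the exponent of the multiple `β⁻ⁿ` of the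
image of `G` under `x ↦ γ₀ⁿ x`, so the limit theorem represents `log g`.
-/

noncomputable section

namespace PadicLimit

/-! ### The additive character -/

section Character

variable {p : ℕ} [Fact p.Prime]

theorem exists_int_eq_of_norm_le_one {a : ℤ} {N : ℕ}
    (h : ‖(a : ℚ_[p]) / (p : ℚ_[p]) ^ N‖ ≤ 1) : ∃ c : ℤ, a = p ^ N * c := by
  have hp : (0 : ℝ) < p := Nat.cast_pos.2 (Fact.out : p.Prime).pos
  have : ‖(a : ℚ_[p])‖ ≤ (p : ℝ) ^ (-N : ℤ) := by
    rw [norm_div, norm_pow, Padic.norm_p, div_le_one (by positivity)] at h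
    simpa [zpow_neg] using h
  exact (Padic.norm_int_le_pow_iff_dvd a N).1 this

theorem exists_fract_eq (x : ℚ_[p]) :
    ∃ (a : ℤ) (N : ℕ), fract x = (a : ℝ) / (p : ℝ) ^ N ∧
      ‖x - (a : ℚ_[p]) / (p : ℚ_[p]) ^ N‖ ≤ 1 := by
  have hp : (0 : ℝ) < p := Nat.cast_pos.2 (Fact.out : p.Prime).pos
  have hp₀ : (p : ℚ_[p]) ≠ 0 := Nat.cast_ne_zero.2 (Fact.out : p.Prime).ne_zero
  set N := fractLength x with hN
  set z : ℤ_[p] := ⟨(p : ℚ_[p]) ^ N * x, norm_pow_fractLength_mul_le x⟩ with hz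
  refine ⟨(z.appr N : ℤ), N, by simp [fract, hz, hN], ?_⟩
  have happr : ‖(p : ℚ_[p]) ^ N * x - (z.appr N : ℚ_[p])‖ ≤ (p : ℝ) ^ (-N : ℤ) := by
    have := (PadicInt.norm_le_pow_iff_mem_span_pow _ N).2 (PadicInt.appr_spec N z)
    rwa [PadicInt.norm_def, PadicInt.coe_sub, PadicInt.coe_natCast] at this
  have hsub : x - ((z.appr N : ℤ) : ℚ_[p]) / (p : ℚ_[p]) ^ N
      = ((p : ℚ_[p]) ^ N * x - (z.appr N : ℚ_[p])) / (p : ℚ_[p]) ^ N := by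
    field_simp; simp
  rw [hsub, norm_div, norm_pow, Padic.norm_p, div_le_one (by positivity)]
  simpa [zpow_neg] using happr

theorem chi_eq_exp {x : ℚ_[p]} {a : ℤ} {N : ℕ}
    (h : ‖x - (a : ℚ_[p]) / (p : ℚ_[p]) ^ N‖ ≤ 1) :
    chi x = Complex.exp (2 * Real.pi * Complex.I * ((a : ℂ) / (p : ℂ) ^ N)) := by
  have hpC : (p : ℂ) ≠ 0 := Nat.cast_ne_zero.2 (Fact.out : p.Prime).ne_zero
  have hp₀ : (p : ℚ_[p]) ≠ 0 := Nat.cast_ne_zero.2 (Fact.out : p.Prime).ne_zero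
  obtain ⟨b, M, hb, hM⟩ := exists_fract_eq x
  have hdiff : ‖((b * p ^ N - a * p ^ M : ℤ) : ℚ_[p]) / (p : ℚ_[p]) ^ (N + M)‖ ≤ 1 := by
    have : ((b * p ^ N - a * p ^ M : ℤ) : ℚ_[p]) / (p : ℚ_[p]) ^ (N + M)
        = (x - (a : ℚ_[p]) / (p : ℚ_[p]) ^ N) - (x - (b : ℚ_[p]) / (p : ℚ_[p]) ^ M) := by
      push_cast; field_simp; ring
    rw [this, sub_eq_add_neg]
    exact (IsUltrametricDist.norm_add_le_max _ _).trans (max_le h (by rwa [norm_neg]))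
  obtain ⟨c, hc⟩ := exists_int_eq_of_norm_le_one hdiff
  have hcC : (b : ℂ) * (p : ℂ) ^ N - a * (p : ℂ) ^ M = (p : ℂ) ^ (N + M) * c := by
    exact_mod_cast hc
  have hba : (b : ℂ) / (p : ℂ) ^ M = a / (p : ℂ) ^ N + c := by
    field_simp
    rw [pow_add] at hcC
    linear_combination hcC
  rw [chi, hb, Complex.exp_eq_exp_iff_exists_int]
  refine ⟨c, ?_⟩
  push_cast
  rw [hba]; ring

theorem chi_add (x y : ℚ_[p]) : chi (x + y) = chi x * chi y := by
  have hpC : (p : ℂ) ≠ 0 := Nat.cast_ne_zero.2 (Fact.out : p.Prime).ne_zero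
  have hp₀ : (p : ℚ_[p]) ≠ 0 := Nat.cast_ne_zero.2 (Fact.out : p.Prime).ne_zero
  obtain ⟨a, N, -, ha⟩ := exists_fract_eq x
  obtain ⟨b, M, -, hb⟩ := exists_fract_eq y
  have hab : ‖x + y - ((a * p ^ M + b * p ^ N : ℤ) : ℚ_[p]) / (p : ℚ_[p]) ^ (N + M)‖ ≤ 1 := by
    have : x + y - ((a * p ^ M + b * p ^ N : ℤ) : ℚ_[p]) / (p : ℚ_[p]) ^ (N + M)
        = (x - (a : ℚ_[p]) / (p : ℚ_[p]) ^ N) + (y - (b : ℚ_[p]) / (p : ℚ_[p]) ^ M) := by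
      push_cast; field_simp; ring
    rw [this]
    exact (IsUltrametricDist.norm_add_le_max _ _).trans (max_le ha hb)
  rw [chi_eq_exp hab, chi_eq_exp ha, chi_eq_exp hb, ← Complex.exp_add]
  congr 1
  push_cast; field_simp; ring

theorem chi_eq_one {x : ℚ_[p]} (hx : ‖x‖ ≤ 1) : chi x = 1 := by
  rw [chi_eq_exp (a := 0) (N := 0) (by simpa using hx)]
  simp

@[simp] theorem chi_zero : chi (0 : ℚ_[p]) = 1 := chi_eq_one (by simp)

@[simp] theorem norm_chi (x : ℚ_[p]) : ‖chi x‖ = 1 := by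
  simpa [chi, mul_right_comm] using Complex.norm_exp_ofReal_mul_I (2 * Real.pi * fract x)

theorem chi_neg (x : ℚ_[p]) : chi (-x) = starRingEnd ℂ (chi x) := by
  rw [← Complex.inv_eq_conj (norm_chi x)]
  exact eq_inv_of_mul_eq_one_left (by rw [← chi_add, neg_add_cancel, chi_zero])

theorem chi_inv_p_ne_one : chi ((p : ℚ_[p])⁻¹) ≠ 1 := by
  have hp : p.Prime := Fact.out
  have hpC : (p : ℂ) ≠ 0 := Nat.cast_ne_zero.2 hp.ne_zero
  rw [chi_eq_exp (a := 1) (N := 1) (by simp), Ne, Complex.exp_eq_one_iff]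
  rintro ⟨n, hn⟩
  rw [mul_comm (n : ℂ)] at hn
  have hn' : ((1 : ℤ) : ℂ) / (p : ℂ) ^ 1 = n := mul_left_cancel₀ Complex.two_pi_I_ne_zero hn
  have hpn : (p : ℤ) * n = 1 := by
    field_simp at hn'
    exact_mod_cast hn'.symm
  exact hp.one_lt.ne' (by exact_mod_cast Int.eq_one_of_mul_eq_one_right (by positivity) hpn)

theorem exists_norm_le_one_chi_mul_ne_one {x : ℚ_[p]} (hx : 1 < ‖x‖) :
    ∃ t : ℚ_[p], ‖t‖ ≤ 1 ∧ chi (t * x) ≠ 1 := by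
  have hx₀ : x ≠ 0 := norm_pos_iff.1 (one_pos.trans hx)
  have hpx : (p : ℝ) ≤ ‖x‖ := by
    by_contra! h
    have := (Padic.norm_le_pow_iff_norm_lt_pow_add_one x 0).2 (by simpa using h)
    exact hx.not_ge (by simpa using this)
  refine ⟨(p : ℚ_[p])⁻¹ / x, ?_, ?_⟩
  · rwa [norm_div, norm_inv, Padic.norm_p, inv_inv, div_le_one (one_pos.trans hx)]
  · rw [div_mul_cancel₀ _ hx₀]
    exact chi_inv_p_ne_one

@[fun_prop] theorem continuous_chi : Continuous (chi : ℚ_[p] → ℂ) := by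
  refine continuous_iff_continuousAt.2 fun x => ?_
  have : (fun _ => chi x) =ᶠ[𝓝 x] chi := by
    filter_upwards [Metric.closedBall_mem_nhds x one_pos] with y hy
    have hyx : chi (y - x) = 1 := chi_eq_one (by simpa [dist_eq_norm] using hy)
    rw [← add_sub_cancel x y, chi_add, hyx, mul_one]
  exact continuousAt_const.congr this

end Character

/-! ### Balls -/

section Balls

variable {p : ℕ} [Fact p.Prime]

theorem setOf_norm_mul_sub_le_one {c : ℚ_[p]} (hc : c ≠ 0) (a : ℚ_[p]) :
    {y | ‖c * (y - a)‖ ≤ 1} = Metric.closedBall a ‖c‖⁻¹ := by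
  ext y
  simp [dist_eq_norm, ← mul_comm ‖c‖, ← one_div, le_div_iff₀ (norm_pos_iff.2 hc)]

/-- The π-system of closed balls of `ℚ_p`. The radii are taken in the value group, so that a ball
is a set `‖c (y - a)‖ ≤ 1` and its indicator is an average of characters. -/
def ballSystem (p : ℕ) [Fact p.Prime] : Set (Set ℚ_[p]) :=
  {s | ∃ a c : ℚ_[p], c ≠ 0 ∧ s = Metric.closedBall a ‖c‖⁻¹}

theorem isPiSystem_ballSystem : IsPiSystem (ballSystem p) := by
  rintro _ ⟨a, c, hc, rfl⟩ _ ⟨b, d, hd, rfl⟩ h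
  rcases IsUltrametricDist.closedBall_subset_trichotomy (x := a) (y := b) (r := ‖c‖⁻¹) (s := ‖d‖⁻¹)
    with hcd | hdc | hdisj
  · exact ⟨a, c, hc, Set.inter_eq_left.2 hcd⟩
  · exact ⟨b, d, hd, Set.inter_eq_right.2 hdc⟩
  · exact absurd hdisj (Set.not_disjoint_iff_nonempty_inter.2 h)

theorem isOpen_of_mem_ballSystem {s : Set ℚ_[p]} (hs : s ∈ ballSystem p) : IsOpen s := by
  obtain ⟨a, c, hc, rfl⟩ := hs
  exact IsUltrametricDist.isOpen_closedBall _ (inv_ne_zero (norm_ne_zero_iff.2 hc))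

theorem isCompact_of_mem_ballSystem {s : Set ℚ_[p]} (hs : s ∈ ballSystem p) : IsCompact s := by
  obtain ⟨a, c, -, rfl⟩ := hs
  exact isCompact_closedBall _ _

theorem isTopologicalBasis_ballSystem : TopologicalSpace.IsTopologicalBasis (ballSystem p) := by
  refine TopologicalSpace.isTopologicalBasis_of_isOpen_of_nhds
    (fun s => isOpen_of_mem_ballSystem) fun x u hx hu => ?_
  obtain ⟨r, hr, hru⟩ := Metric.isOpen_iff.1 hu x hx
  obtain ⟨c, hc⟩ := NormedField.exists_lt_norm ℚ_[p] r⁻¹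
  have hc₀ : 0 < ‖c‖ := (inv_pos.2 hr).trans hc
  exact ⟨_, ⟨x, c, norm_pos_iff.1 hc₀, rfl⟩, Metric.mem_closedBall_self (by positivity),
    (Metric.closedBall_subset_ball (inv_lt_of_inv_lt₀ hr hc)).trans hru⟩

theorem ext_of_ballSystem [MeasurableSpace ℚ_[p]] [BorelSpace ℚ_[p]] {μ ν : Measure ℚ_[p]}
    [IsFiniteMeasure μ] (h : ∀ s ∈ ballSystem p, μ s = ν s) : μ = ν := by
  have hp : (1 : ℝ) < p := Nat.one_lt_cast.2 (Fact.out : p.Prime).one_lt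
  refine Measure.ext_of_generateFrom_of_iUnion (ballSystem p)
    (fun n : ℕ => Metric.closedBall (0 : ℚ_[p]) ‖(p : ℚ_[p]) ^ n‖⁻¹)
    (BorelSpace.measurable_eq.trans isTopologicalBasis_ballSystem.borel_eq_generateFrom)
    isPiSystem_ballSystem ?_ (fun n => ?_) (fun n => measure_ne_top _ _) h
  · refine Set.eq_univ_of_forall fun x => Set.mem_iUnion.2 ?_
    obtain ⟨n, hn⟩ := pow_unbounded_of_one_lt ‖x‖ hp
    exact ⟨n, by simpa using hn.le⟩
  · exact ⟨0, (p : ℚ_[p]) ^ n, pow_ne_zero _ (Nat.cast_ne_zero.2 (Fact.out : p.Prime).ne_zero),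
      rfl⟩

/-- The complement `‖c y‖ > 1` of the ball of radius `‖c‖⁻¹` around zero (empty if `c = 0`). It is
the set of all `y` on which some character `y ↦ χ(ty)` with `‖t‖ ≤ ‖c‖` can differ from `1`. -/
def outer (c : ℚ_[p]) : Set ℚ_[p] := {y | 1 < ‖c * y‖}

theorem isOpen_outer (c : ℚ_[p]) : IsOpen (outer c) :=
  isOpen_lt (by fun_prop) (by fun_prop)

theorem isClosed_outer (c : ℚ_[p]) : IsClosed (outer c) := by
  rcases eq_or_ne c 0 with rfl | hc
  · simp [outer, not_lt.2 zero_le_one]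
  · have : outer c = (Metric.closedBall 0 ‖c‖⁻¹)ᶜ := by
      rw [← setOf_norm_mul_sub_le_one hc]; ext; simp [outer]
    rw [this, isClosed_compl_iff]
    exact IsUltrametricDist.isOpen_closedBall _ (inv_ne_zero (norm_ne_zero_iff.2 hc))

theorem zero_notMem_outer (c : ℚ_[p]) : (0 : ℚ_[p]) ∉ outer c := by
  simp [outer]

theorem outer_subset_outer {s c : ℚ_[p]} (h : ‖s‖ ≤ ‖c‖) : outer s ⊆ outer c := fun y hy => by
  simp only [outer, Set.mem_ofPred_eq, norm_mul] at hy ⊢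
  exact hy.trans_le (by gcongr)

theorem preimage_mul_outer (c s : ℚ_[p]) : (c * ·) ⁻¹' outer s = outer (s * c) := by
  ext; simp [outer, mul_assoc]

theorem chi_mul_eq_one_of_notMem_outer {t y : ℚ_[p]} (h : y ∉ outer t) : chi (t * y) = 1 :=
  chi_eq_one (not_lt.1 h)

theorem exists_outer_subset_compl {U : Set ℚ_[p]} (hU : U ∈ 𝓝 0) : ∃ c : ℚ_[p], Uᶜ ⊆ outer c := by
  obtain ⟨r, hr, hrU⟩ := Metric.mem_nhds_iff.1 hU
  obtain ⟨c, hc⟩ := NormedField.exists_lt_norm ℚ_[p] r⁻¹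
  refine ⟨c, fun y hy => ?_⟩
  have hry : r ≤ ‖y‖ := by simpa using fun h => hy (hrU h)
  calc 1 = r⁻¹ * r := (inv_mul_cancel₀ hr.ne').symm
    _ < ‖c‖ * ‖y‖ := mul_lt_mul hc hry hr (norm_nonneg _)
    _ = ‖c * y‖ := (norm_mul _ _).symm

theorem eventually_norm_le_norm_inv_pow (t : ℚ_[p]) :
    ∀ᶠ n : ℕ in atTop, ‖t‖ ≤ ‖((p : ℚ_[p]) ^ n)⁻¹‖ := by
  have hp : (1 : ℝ) < p := Nat.one_lt_cast.2 (Fact.out : p.Prime).one_lt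
  simpa using (tendsto_pow_atTop_atTop_of_one_lt hp).eventually_ge_atTop ‖t‖

theorem iUnion_outer_inv_pow : ⋃ n : ℕ, outer ((p : ℚ_[p]) ^ n)⁻¹ = {0}ᶜ := by
  ext y
  simp only [Set.mem_iUnion, Set.mem_compl_singleton_iff]
  refine ⟨fun ⟨n, hn⟩ hy => zero_notMem_outer _ (hy ▸ hn), fun hy => ?_⟩
  obtain ⟨c, hc⟩ := exists_outer_subset_compl (isClosed_singleton.isOpen_compl.mem_nhds hy.symm)
  obtain ⟨n, hn⟩ := (eventually_norm_le_norm_inv_pow c).exists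
  exact ⟨n, outer_subset_outer hn (hc (by simp))⟩

end Balls

/-! ### Characteristic functions and Lévy exponents -/

section LevyExponent

variable {p : ℕ} [Fact p.Prime] [MeasurableSpace ℚ_[p]]

/-- The Lévy exponent `∫ (χ(ty) - 1) Φ(dy)` of a measure `Φ`, the logarithm of `levyExp Φ`. The
integrand vanishes at `y = 0`, so `0` need not be removed from the domain of integration. -/
def levyExponent (Φ : Measure ℚ_[p]) (t : ℚ_[p]) : ℂ := ∫ y, (chi (t * y) - 1) ∂Φ

theorem charFn_zero_eq (μ : Measure ℚ_[p]) : charFn μ 0 = μ.real Set.univ := by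
  simp [charFn]

theorem norm_charFn_le (μ : Measure ℚ_[p]) [IsFiniteMeasure μ] (t : ℚ_[p]) :
    ‖charFn μ t‖ ≤ μ.real Set.univ := by
  simpa [charFn] using norm_integral_le_of_norm_le_const (μ := μ) (f := fun x => chi (t * x))
    (C := 1) (by simp)

theorem setIntegral_chi_sub_one (Φ : Measure ℚ_[p]) {t : ℚ_[p]} {E : Set ℚ_[p]}
    (hE : outer t ⊆ E) :
    ∫ y in E, (chi (t * y) - 1) ∂Φ = levyExponent Φ t :=
  setIntegral_eq_integral_of_forall_compl_eq_zero fun y hy => by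
    rw [chi_mul_eq_one_of_notMem_outer (fun h => hy (hE h)), sub_self]

theorem levyExp_eq_exp_levyExponent (Φ : Measure ℚ_[p]) (t : ℚ_[p]) :
    levyExp Φ t = Complex.exp (levyExponent Φ t) := by
  rw [levyExp, setIntegral_chi_sub_one]
  exact Set.subset_compl_singleton_iff.2 (zero_notMem_outer t)

theorem levyExponent_restrict_outer (Φ : Measure ℚ_[p]) {t c : ℚ_[p]} (h : ‖t‖ ≤ ‖c‖) :
    levyExponent (Φ.restrict (outer c)) t = levyExponent Φ t :=
  setIntegral_chi_sub_one Φ (outer_subset_outer h)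

theorem charFn_neg (μ : Measure ℚ_[p]) (t : ℚ_[p]) :
    charFn μ (-t) = starRingEnd ℂ (charFn μ t) := by
  simp only [charFn, ← integral_conj, ← chi_neg, neg_mul]

theorem levyExponent_neg (Φ : Measure ℚ_[p]) (t : ℚ_[p]) :
    levyExponent Φ (-t) = starRingEnd ℂ (levyExponent Φ t) := by
  simp only [levyExponent, ← integral_conj, map_sub, map_one, ← chi_neg, neg_mul]

theorem levyExponent_ofReal_smul (Φ : Measure ℚ_[p]) {a : ℝ} (ha : 0 ≤ a) (t : ℚ_[p]) :
    levyExponent (ENNReal.ofReal a • Φ) t = a * levyExponent Φ t := by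
  simp [levyExponent, integral_smul_measure, ENNReal.toReal_ofReal ha]

variable [BorelSpace ℚ_[p]]

@[fun_prop] theorem measurable_chi : Measurable (chi : ℚ_[p] → ℂ) := continuous_chi.measurable

theorem measurableSet_outer (c : ℚ_[p]) : MeasurableSet (outer c) :=
  (isOpen_outer c).measurableSet

theorem integrable_chi_mul (μ : Measure ℚ_[p]) [IsFiniteMeasure μ] (t : ℚ_[p]) :
    Integrable (fun x => chi (t * x)) μ :=
  Integrable.of_bound (Measurable.aestronglyMeasurable (by fun_prop)) 1 (by simp)

@[fun_prop] theorem continuous_charFn (μ : Measure ℚ_[p]) [IsFiniteMeasure μ] :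
    Continuous (charFn μ) :=
  continuous_of_dominated (bound := fun _ => 1)
    (fun t => Measurable.aestronglyMeasurable (by fun_prop)) (by simp) (integrable_const _)
    (.of_forall fun x => by fun_prop)

theorem levyExponent_eq_charFn_sub (ν : Measure ℚ_[p]) [IsFiniteMeasure ν] (t : ℚ_[p]) :
    levyExponent ν t = charFn ν t - ν.real Set.univ := by
  rw [levyExponent, integral_sub (integrable_chi_mul ν t) (integrable_const _)]
  simp [charFn]

theorem charFn_map_const_mul (μ : Measure ℚ_[p]) (c t : ℚ_[p]) :
    charFn (μ.map (c * ·)) t = charFn μ (t * c) := by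
  unfold charFn
  rw [integral_map (by fun_prop) (Measurable.aestronglyMeasurable (by fun_prop))]
  simp only [mul_assoc]

theorem levyExponent_map_const_mul (Φ : Measure ℚ_[p]) (c t : ℚ_[p]) :
    levyExponent (Φ.map (c * ·)) t = levyExponent Φ (t * c) := by
  unfold levyExponent
  rw [integral_map (by fun_prop) (Measurable.aestronglyMeasurable (by fun_prop))]
  simp only [mul_assoc]

end LevyExponent

/-! ### Fourier inversion on balls -/

section FourierInversion

variable {p : ℕ} [Fact p.Prime] [MeasurableSpace ℚ_[p]] [BorelSpace ℚ_[p]]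

/-- The closed unit ball of `ℚ_p` as a compact set with nonempty interior, the normalization of the
Haar measure underlying `unitHaar`. -/
def unitBall : TopologicalSpace.PositiveCompacts ℚ_[p] where
  carrier := Metric.closedBall 0 1
  isCompact' := isCompact_closedBall _ _
  interior_nonempty' := ⟨0, mem_interior_iff_mem_nhds.2 (Metric.closedBall_mem_nhds 0 one_pos)⟩

/-- The Haar probability measure of the closed unit ball, as a measure on `ℚ_p`: averages over
balls are integrals against it. -/
def unitHaar (p : ℕ) [Fact p.Prime] [MeasurableSpace ℚ_[p]] [BorelSpace ℚ_[p]] :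
    Measure ℚ_[p] :=
  (Measure.addHaarMeasure unitBall).restrict (Metric.closedBall 0 1)

instance : IsProbabilityMeasure (unitHaar p) := ⟨by
  rw [unitHaar, Measure.restrict_apply_univ]
  exact Measure.addHaarMeasure_self (K₀ := unitBall)⟩

theorem ae_unitHaar_norm_le_one : ∀ᵐ u ∂(unitHaar p), ‖u‖ ≤ 1 := by
  filter_upwards [ae_restrict_mem (s := Metric.closedBall (0 : ℚ_[p]) 1)
    (μ := Measure.addHaarMeasure unitBall) Metric.isClosed_closedBall.measurableSet] with u hu
  simpa using hu

theorem ae_unitHaar_norm_mul_le (c : ℚ_[p]) : ∀ᵐ u ∂(unitHaar p), ‖c * u‖ ≤ ‖c‖ := by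
  filter_upwards [ae_unitHaar_norm_le_one] with u hu
  rw [norm_mul]
  exact mul_le_of_le_one_right (norm_nonneg c) hu

theorem integrable_unitHaar {E : Type*} [NormedAddCommGroup E] {f : ℚ_[p] → E}
    (hf : Continuous f) : Integrable f (unitHaar p) :=
  hf.continuousOn.integrableOn_compact (isCompact_closedBall _ _)

theorem integral_unitHaar_add_right (f : ℚ_[p] → ℂ) {v : ℚ_[p]} (hv : ‖v‖ ≤ 1) :
    ∫ u, f (u + v) ∂(unitHaar p) = ∫ u, f u ∂(unitHaar p) := by
  have hB : MeasurableSet (Metric.closedBall (0 : ℚ_[p]) 1) :=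
    Metric.isClosed_closedBall.measurableSet
  have hpre : (· + v) ⁻¹' Metric.closedBall (0 : ℚ_[p]) 1 = Metric.closedBall 0 1 := by
    rw [Metric.preimage_add_right_closedBall]
    exact IsUltrametricDist.closedBall_eq_of_mem (by simpa using hv)
  have hmp := (measurePreserving_add_right (Measure.addHaarMeasure (unitBall (p := p))) v)
  have := (hmp.restrict_preimage hB).integral_comp (measurableEmbedding_addRight v) f
  rwa [hpre] at this

theorem integral_chi_unitHaar (y : ℚ_[p]) :
    ∫ u, chi (u * y) ∂(unitHaar p) = {y : ℚ_[p] | ‖y‖ ≤ 1}.indicator 1 y := by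
  by_cases hy : ‖y‖ ≤ 1
  · rw [Set.indicator_of_mem (by exact hy)]
    have : (fun u => chi (u * y)) =ᵐ[unitHaar p] fun _ => 1 := by
      filter_upwards [ae_unitHaar_norm_le_one] with u hu
      exact chi_eq_one ((norm_mul u y).trans_le (mul_le_one₀ hu (norm_nonneg _) hy))
    simp [integral_congr_ae this]
  · rw [Set.indicator_of_notMem (by exact hy)]
    obtain ⟨t, ht, htx⟩ := exists_norm_le_one_chi_mul_ne_one (not_le.1 hy)
    have h := integral_unitHaar_add_right (fun u => chi (u * y)) ht
    simp only [add_mul, chi_add, integral_mul_const] at h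
    by_contra h₀
    exact htx (mul_left_cancel₀ h₀ (by rw [h, mul_one]))

theorem integral_charFn_unitHaar (μ : Measure ℚ_[p]) [IsFiniteMeasure μ] (s c a : ℚ_[p]) :
    ∫ u, chi (-(c * u * a)) * charFn μ (s + c * u) ∂(unitHaar p)
      = ∫ y in {y | ‖c * (y - a)‖ ≤ 1}, chi (s * y) ∂μ := by
  have hS : MeasurableSet {y : ℚ_[p] | ‖c * (y - a)‖ ≤ 1} :=
    measurableSet_le (by fun_prop) (by fun_prop)
  have hchi : ∀ u y : ℚ_[p], chi (-(c * u * a)) * chi ((s + c * u) * y)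
      = chi (s * y) * chi (u * (c * (y - a))) := by
    intro u y
    rw [← chi_add, ← chi_add]; ring_nf
  have hint : Integrable (Function.uncurry fun u y => chi (s * y) * chi (u * (c * (y - a))))
      ((unitHaar p).prod μ) := by
    refine Integrable.of_bound (Measurable.aestronglyMeasurable ?_) 1
      (.of_forall fun z => by simp [Function.uncurry_def])
    simp only [Function.uncurry_def]
    fun_prop
  simp only [charFn, ← integral_const_mul, hchi]
  rw [integral_integral_swap hint, ← integral_indicator hS]
  simp only [integral_const_mul, integral_chi_unitHaar]
  congr with y
  simp [Set.indicator]

theorem ofReal_measureReal_closedBall (μ : Measure ℚ_[p]) [IsFiniteMeasure μ] {c : ℚ_[p]}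
    (hc : c ≠ 0) (a : ℚ_[p]) :
    ((μ.real (Metric.closedBall a ‖c‖⁻¹) : ℝ) : ℂ)
      = ∫ u, chi (-(c * u * a)) * charFn μ (c * u) ∂(unitHaar p) := by
  have := integral_charFn_unitHaar μ 0 c a
  simp only [zero_add, zero_mul, chi_zero] at this
  rw [this, setOf_norm_mul_sub_le_one hc]
  simp

theorem ext_of_charFn {μ ν : Measure ℚ_[p]} [IsFiniteMeasure μ] [IsFiniteMeasure ν]
    (h : ∀ t, charFn μ t = charFn ν t) : μ = ν := by
  refine ext_of_ballSystem ?_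
  rintro _ ⟨a, c, hc, rfl⟩
  rw [← measureReal_eq_measureReal_iff]
  have := ofReal_measureReal_closedBall μ hc a
  simp only [h, ← ofReal_measureReal_closedBall ν hc a] at this
  exact_mod_cast this

/-- The deviation of `f` at `s` from its mean over the ball `s + c ℤ_p`. Applied to the
characteristic function or to the Lévy exponent of a measure, it yields the characteristic function
of the restriction of the measure to `outer c`. -/
def ballDeviation (f : ℚ_[p] → ℂ) (c s : ℚ_[p]) : ℂ := ∫ u, (f s - f (s + c * u)) ∂(unitHaar p)

theorem continuous_ballDeviation {f : ℚ_[p] → ℂ} (hf : Continuous f) (c : ℚ_[p]) :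
    Continuous (ballDeviation f c) :=
  continuous_parametric_integral_of_continuous (f := fun s u => f s - f (s + c * u))
    (by fun_prop) (isCompact_closedBall _ _)

theorem ballDeviation_eq_sub {f : ℚ_[p] → ℂ} (hf : Continuous f) (c s : ℚ_[p]) :
    ballDeviation f c s = f s - ∫ u, f (s + c * u) ∂(unitHaar p) := by
  rw [ballDeviation, integral_sub (integrable_const _) (integrable_unitHaar (by fun_prop)),
    integral_const, probReal_univ, one_smul]

/-- The ball `s + c ℤ_p` is unchanged if `s` moves by `v ∈ c ℤ_p`, so the two means agree. -/
theorem ballDeviation_sub_ballDeviation {f : ℚ_[p] → ℂ} (hf : Continuous f) {c v : ℚ_[p]}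
    (hv : ‖v‖ ≤ ‖c‖) (s : ℚ_[p]) :
    ballDeviation f c s - ballDeviation f c (s + v) = f s - f (s + v) := by
  obtain ⟨w, hw, rfl⟩ : ∃ w : ℚ_[p], ‖w‖ ≤ 1 ∧ v = c * w := by
    rcases eq_or_ne c 0 with rfl | hc
    · exact ⟨0, by simp, by simpa using hv⟩
    · exact ⟨c⁻¹ * v, by
        rwa [norm_mul, norm_inv, inv_mul_le_one₀ (norm_pos_iff.2 hc)], by field_simp⟩
  have hmean : ∫ u, f (s + c * w + c * u) ∂(unitHaar p) = ∫ u, f (s + c * u) ∂(unitHaar p) := by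
    rw [← integral_unitHaar_add_right (fun u => f (s + c * u)) hw]
    congr with u
    ring_nf
  rw [ballDeviation_eq_sub hf, ballDeviation_eq_sub hf, hmean, sub_sub_sub_cancel_right]

theorem ballDeviation_ballDeviation {f : ℚ_[p] → ℂ} (hf : Continuous f) {c d : ℚ_[p]}
    (hcd : ‖c‖ ≤ ‖d‖) (s : ℚ_[p]) :
    ballDeviation (ballDeviation f d) c s = ballDeviation f c s := by
  refine integral_congr_ae ?_
  filter_upwards [ae_unitHaar_norm_mul_le c] with u hu
  exact ballDeviation_sub_ballDeviation hf (hu.trans hcd) s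

theorem charFn_restrict_outer (μ : Measure ℚ_[p]) [IsFiniteMeasure μ] (c s : ℚ_[p]) :
    charFn (μ.restrict (outer c)) s = ballDeviation (charFn μ) c s := by
  have hball : ∫ u, charFn μ (s + c * u) ∂(unitHaar p) = ∫ y in (outer c)ᶜ, chi (s * y) ∂μ := by
    have hcompl : (outer c)ᶜ = {y | ‖c * (y - 0)‖ ≤ 1} := by ext; simp [outer]
    rw [hcompl]
    simpa using integral_charFn_unitHaar μ s c 0
  rw [ballDeviation_eq_sub (continuous_charFn μ), hball, charFn, charFn,
    ← integral_add_compl (measurableSet_outer c) (integrable_chi_mul μ s), add_sub_cancel_right]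

/-- The part of `Φ` outside a ball can be computed from the Lévy exponent of `Φ`, even if `Φ` has
infinite mass near zero. -/
theorem charFn_restrict_outer_eq_ballDeviation_levyExponent {Φ : Measure ℚ_[p]}
    (hΦ : ∀ c, Φ (outer c) < ⊤) (c s : ℚ_[p]) :
    charFn (Φ.restrict (outer c)) s = ballDeviation (levyExponent Φ) c s := by
  obtain ⟨d, hs, hc⟩ : ∃ d : ℚ_[p], ‖s‖ ≤ ‖d‖ ∧ ‖c‖ ≤ ‖d‖ := by
    rcases le_total ‖s‖ ‖c‖ with h | h
    · exact ⟨c, h, le_rfl⟩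
    · exact ⟨s, le_rfl, h⟩
  have : IsFiniteMeasure (Φ.restrict (outer d)) := isFiniteMeasure_restrict.2 (hΦ d).ne
  rw [← Measure.restrict_restrict_of_subset (outer_subset_outer hc), charFn_restrict_outer]
  refine integral_congr_ae ?_
  filter_upwards [ae_unitHaar_norm_mul_le c] with u hu
  have hsu : ‖s + c * u‖ ≤ ‖d‖ :=
    (IsUltrametricDist.norm_add_le_max _ _).trans (max_le hs (hu.trans hc))
  rw [← levyExponent_restrict_outer Φ hs, ← levyExponent_restrict_outer Φ hsu,
    levyExponent_eq_charFn_sub, levyExponent_eq_charFn_sub, sub_sub_sub_cancel_right]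

end FourierInversion

/-! ### Lévy measures -/

section LevyMeasure

variable {p : ℕ} [Fact p.Prime] [MeasurableSpace ℚ_[p]]

theorem IsLevyMeasure.outer_lt_top {Φ : Measure ℚ_[p]} (hΦ : IsLevyMeasure Φ) (c : ℚ_[p]) :
    Φ (outer c) < ⊤ := by
  have := hΦ.finite_compl (outer c)ᶜ ((isClosed_outer c).isOpen_compl.mem_nhds
    (zero_notMem_outer c))
  rwa [compl_compl] at this

theorem isLevyMeasure_of_outer_lt_top {Φ : Measure ℚ_[p]} (h₀ : Φ {0} = 0)
    (hΦ : ∀ c, Φ (outer c) < ⊤) : IsLevyMeasure Φ where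
  zero_null := h₀
  finite_compl U hU := by
    obtain ⟨c, hc⟩ := exists_outer_subset_compl hU
    exact (measure_mono hc).trans_lt (hΦ c)

theorem IsLevyMeasure.isFiniteMeasure_restrict_outer {Φ : Measure ℚ_[p]} (hΦ : IsLevyMeasure Φ)
    (c : ℚ_[p]) : IsFiniteMeasure (Φ.restrict (outer c)) :=
  isFiniteMeasure_restrict.2 (hΦ.outer_lt_top c).ne

theorem IsLevyMeasure.ofReal_smul {Φ : Measure ℚ_[p]} (hΦ : IsLevyMeasure Φ) (a : ℝ) :
    IsLevyMeasure (ENNReal.ofReal a • Φ) where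
  zero_null := by simp [hΦ.zero_null]
  finite_compl U hU := ENNReal.mul_lt_top ENNReal.ofReal_lt_top (hΦ.finite_compl U hU)

theorem IsLevyMeasure.ext_of_restrict_outer {Φ Ψ : Measure ℚ_[p]} (hΦ : IsLevyMeasure Φ)
    (hΨ : IsLevyMeasure Ψ) (h : ∀ c, Φ.restrict (outer c) = Ψ.restrict (outer c)) : Φ = Ψ := by
  have hrestrict : ∀ Ξ : Measure ℚ_[p], IsLevyMeasure Ξ →
      Ξ = Ξ.restrict (⋃ n : ℕ, outer ((p : ℚ_[p]) ^ n)⁻¹) := fun Ξ hΞ => by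
    rw [iUnion_outer_inv_pow]
    exact (Measure.restrict_eq_self_of_ae_mem (compl_mem_ae_iff.2 hΞ.zero_null)).symm
  rw [hrestrict Φ hΦ, hrestrict Ψ hΨ, Measure.restrict_iUnion_congr]
  exact fun n => h _

variable [BorelSpace ℚ_[p]]

theorem IsLevyMeasure.map_const_mul {Φ : Measure ℚ_[p]} (hΦ : IsLevyMeasure Φ) {c : ℚ_[p]}
    (hc : c ≠ 0) : IsLevyMeasure (Φ.map (c * ·)) := by
  refine isLevyMeasure_of_outer_lt_top ?_ fun s => ?_
  · have : (c * ·) ⁻¹' {0} = ({0} : Set ℚ_[p]) := by ext; simp [hc]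
    rw [Measure.map_apply (by fun_prop) (measurableSet_singleton 0), this, hΦ.zero_null]
  · rw [Measure.map_apply (by fun_prop) (measurableSet_outer s), preimage_mul_outer]
    exact hΦ.outer_lt_top _

theorem IsLevyMeasure.ext_of_isCompact_isOpen {Φ Ψ : Measure ℚ_[p]} (hΦ : IsLevyMeasure Φ)
    (hΨ : IsLevyMeasure Ψ)
    (h : ∀ M : Set ℚ_[p], IsCompact M → IsOpen M → (0 : ℚ_[p]) ∉ M → Φ M = Ψ M) : Φ = Ψ := by
  refine hΦ.ext_of_restrict_outer hΨ fun c => ?_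
  have := hΦ.isFiniteMeasure_restrict_outer c
  refine ext_of_ballSystem fun s hs => ?_
  have hso := isOpen_of_mem_ballSystem hs
  rw [Measure.restrict_apply hso.measurableSet, Measure.restrict_apply hso.measurableSet]
  exact h _ ((isCompact_of_mem_ballSystem hs).inter_right (isClosed_outer c))
    (hso.inter (isOpen_outer c)) fun h₀ => zero_notMem_outer c h₀.2

theorem IsLevyMeasure.ext_of_levyExponent {Φ Ψ : Measure ℚ_[p]} (hΦ : IsLevyMeasure Φ)
    (hΨ : IsLevyMeasure Ψ) (h : ∀ t, levyExponent Φ t = levyExponent Ψ t) : Φ = Ψ := by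
  refine hΦ.ext_of_restrict_outer hΨ fun c => ?_
  have := hΦ.isFiniteMeasure_restrict_outer c
  have := hΨ.isFiniteMeasure_restrict_outer c
  refine ext_of_charFn fun s => ?_
  rw [charFn_restrict_outer_eq_ballDeviation_levyExponent hΦ.outer_lt_top,
    charFn_restrict_outer_eq_ballDeviation_levyExponent hΨ.outer_lt_top, funext h]

theorem IsLevyMeasure.continuous_levyExponent {Φ : Measure ℚ_[p]} (hΦ : IsLevyMeasure Φ) :
    Continuous (levyExponent Φ) := by
  refine continuous_iff_continuousAt.2 fun t => ?_
  obtain ⟨c, hc⟩ := NormedField.exists_lt_norm ℚ_[p] ‖t‖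
  have := hΦ.isFiniteMeasure_restrict_outer c
  have hcont : Continuous (levyExponent (Φ.restrict (outer c))) := by
    simp only [funext (levyExponent_eq_charFn_sub (Φ.restrict (outer c)))]
    fun_prop
  refine hcont.continuousAt.congr ?_
  filter_upwards [continuous_norm.continuousAt.eventually_lt_const hc] with s hs
  exact levyExponent_restrict_outer Φ hs.le

theorem scalingRelation_iff_map_eq {Φ : Measure ℚ_[p]} (hΦ : IsLevyMeasure Φ) {β : ℝ}
    {γ : ℚ_[p]} (hγ : γ ≠ 0) :
    ScalingRelation Φ β γ ↔ Φ.map (γ * ·) = ENNReal.ofReal β • Φ := by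
  have hmap : ∀ M : Set ℚ_[p], IsOpen M → Φ.map (γ * ·) M = Φ (γ⁻¹ • M) := fun M hM => by
    rw [Measure.map_apply (by fun_prop) hM.measurableSet, ← Set.preimage_smul₀ hγ]
    rfl
  constructor
  · intro h
    refine (hΦ.map_const_mul hγ).ext_of_isCompact_isOpen (hΦ.ofReal_smul β) fun M hMc hMo hM₀ => ?_
    rw [hmap M hMo, h _ (hMc.smul _) (hMo.smul₀ (inv_ne_zero hγ))
      (by rwa [Set.zero_mem_smul_set_iff (inv_ne_zero hγ)]), smul_inv_smul₀ hγ]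
    rfl
  · intro h M _ hMo _
    rw [← smul_eq_mul, ← Measure.smul_apply, ← h, hmap _ (hMo.smul₀ hγ), inv_smul_smul₀ hγ]

theorem scalingRelation_iff_levyExponent {Φ : Measure ℚ_[p]} (hΦ : IsLevyMeasure Φ) {β : ℝ}
    (hβ : 0 ≤ β) {γ : ℚ_[p]} (hγ : γ ≠ 0) :
    ScalingRelation Φ β γ ↔ ∀ t, levyExponent Φ (t * γ) = β * levyExponent Φ t := by
  simp only [scalingRelation_iff_map_eq hΦ hγ, ← levyExponent_map_const_mul Φ γ,
    ← levyExponent_ofReal_smul Φ hβ]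
  exact ⟨fun h t => by rw [h], (hΦ.map_const_mul hγ).ext_of_levyExponent (hΦ.ofReal_smul β)⟩

theorem isSymm_iff_map_neg_eq {μ : Measure ℚ_[p]} :
    IsSymm μ ↔ μ.map (-1 * ·) = μ := by
  have hpre : ∀ M : Set ℚ_[p], (-1 * ·) ⁻¹' M = -M := fun M => by ext; simp
  constructor
  · intro h
    ext M hM
    rw [Measure.map_apply (by fun_prop) hM, hpre, h M hM]
  · intro h M hM
    rw [← hpre, ← Measure.map_apply (by fun_prop) hM, h]

theorem IsLevyMeasure.isSymm_of_conj_levyExponent {Φ : Measure ℚ_[p]} (hΦ : IsLevyMeasure Φ)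
    (h : ∀ t, starRingEnd ℂ (levyExponent Φ t) = levyExponent Φ t) : IsSymm Φ :=
  isSymm_iff_map_neg_eq.2 <| (hΦ.map_const_mul (neg_ne_zero.2 one_ne_zero)).ext_of_levyExponent hΦ
    fun t => by rw [levyExponent_map_const_mul, mul_neg_one, levyExponent_neg, h]

theorem IsSymm.conj_charFn {μ : Measure ℚ_[p]} (h : IsSymm μ) (t : ℚ_[p]) :
    starRingEnd ℂ (charFn μ t) = charFn μ t := by
  nth_rewrite 2 [← isSymm_iff_map_neg_eq.1 h]
  rw [charFn_map_const_mul, mul_neg_one, charFn_neg]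

end LevyMeasure

/-! ### Lévy's continuity theorem -/

theorem exists_isCompact_of_isTightMeasureSet {E : Type*} [TopologicalSpace E] [T2Space E]
    [NormalSpace E] [MeasurableSpace E] [BorelSpace E] {S : Set (FiniteMeasure E)} {C : NNReal}
    (hC : ∀ μ ∈ S, μ.mass ≤ C)
    (hS : IsTightMeasureSet ((fun μ : FiniteMeasure E => (μ : Measure E)) '' S)) :
    ∃ T : Set (FiniteMeasure E), IsCompact T ∧ S ⊆ T := by
  obtain ⟨u, -, hu₀, hu⟩ :
      ∃ u : ℕ → NNReal, StrictAnti u ∧ (∀ n, 0 < u n) ∧ Tendsto u atTop (𝓝 0) :=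
    exists_seq_strictAnti_tendsto 0
  have hK : ∀ n, ∃ K : Set E, IsCompact K ∧ ∀ μ ∈ S, (μ : Measure E) Kᶜ ≤ u n := fun n => by
    simpa using isTightMeasureSet_iff_exists_isCompact_measure_compl_le.1 hS (u n)
      (ENNReal.coe_pos.2 (hu₀ n))
  choose K hKc hKS using hK
  refine ⟨_, isCompact_setOfPred_finiteMeasure_mass_le_compl_isCompact_le C hu hKc
    (.inl inferInstance), fun μ hμ => ⟨hC μ hμ, fun n => ?_⟩⟩
  exact ENNReal.coe_le_coe.1 (by simpa using hKS n μ hμ)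

section Continuity

variable {p : ℕ} [Fact p.Prime] [MeasurableSpace ℚ_[p]] [BorelSpace ℚ_[p]]

theorem tendsto_charFn_restrict_outer {ν : ℕ → Measure ℚ_[p]} [∀ n, IsFiniteMeasure (ν n)]
    {L : ℚ_[p] → ℂ} {b : ℚ_[p] → ℝ} (hb : Continuous b)
    (hν : ∀ n t, ‖levyExponent (ν n) t‖ ≤ b t)
    (hL : ∀ t, Tendsto (fun n => levyExponent (ν n) t) atTop (𝓝 (L t))) (c s : ℚ_[p]) :
    Tendsto (fun n => charFn ((ν n).restrict (outer c)) s) atTop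
      (𝓝 (ballDeviation L c s)) := by
  have hcont : ∀ n, Continuous (levyExponent (ν n)) := fun n => by
    simp only [funext (levyExponent_eq_charFn_sub (ν n))]
    fun_prop
  simp only [charFn_restrict_outer_eq_ballDeviation_levyExponent
    fun c => measure_lt_top (ν _) (outer c)]
  refine tendsto_integral_of_dominated_convergence (fun u => b s + b (s + c * u))
    (fun n => (integrable_unitHaar (by fun_prop)).aestronglyMeasurable)
    (integrable_unitHaar (by fun_prop))
    (fun n => .of_forall fun u => norm_sub_le_of_le (hν n _) (hν n _))
    (.of_forall fun u => (hL _).sub (hL _))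

theorem exists_eventually_measure_outer_le {ν : ℕ → Measure ℚ_[p]} [∀ n, IsFiniteMeasure (ν n)]
    {L : ℚ_[p] → ℂ} {b : ℚ_[p] → ℝ} (hb : Continuous b)
    (hν : ∀ n t, ‖levyExponent (ν n) t‖ ≤ b t)
    (hL : ∀ t, Tendsto (fun n => levyExponent (ν n) t) atTop (𝓝 (L t)))
    (hL₀ : ContinuousAt L 0) {ε : ENNReal} (hε : 0 < ε) :
    ∃ c : ℚ_[p], c ≠ 0 ∧ ∀ᶠ n in atTop, ν n (outer c) ≤ ε := by
  obtain ⟨δ, hδ, hδε⟩ : ∃ δ : ℝ, 0 < δ ∧ ENNReal.ofReal δ ≤ ε := by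
    obtain ⟨δ, hδ, hδε⟩ := ENNReal.lt_iff_exists_nnreal_btwn.1 hε
    exact ⟨δ, NNReal.coe_pos.2 (ENNReal.coe_pos.1 hδ), by simpa using hδε.le⟩
  obtain ⟨η, hη, hball⟩ := Metric.continuousAt_iff.1 hL₀ (δ / 2) (half_pos hδ)
  obtain ⟨c, hc₀, hc⟩ := NormedField.exists_norm_lt ℚ_[p] hη
  have hsmall : ‖ballDeviation L c 0‖ < δ := by
    have hae : ∀ᵐ u ∂(unitHaar p), ‖L 0 - L (0 + c * u)‖ ≤ δ / 2 := by
      filter_upwards [ae_unitHaar_norm_mul_le c] with u hu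
      rw [zero_add, norm_sub_rev, ← dist_eq_norm]
      exact (hball (by simpa using hu.trans_lt hc)).le
    calc _ ≤ δ / 2 * (unitHaar p).real Set.univ := norm_integral_le_of_norm_le_const hae
      _ < δ := by simpa using half_lt_self hδ
  refine ⟨c, norm_pos_iff.1 hc₀, ?_⟩
  filter_upwards [(tendsto_charFn_restrict_outer hb hν hL c 0).norm.eventually_le_const hsmall]
    with n hn
  refine le_trans ?_ hδε
  rw [charFn_zero_eq, measureReal_restrict_apply_univ, Complex.norm_real,
    Real.norm_of_nonneg measureReal_nonneg] at hn
  rw [← ofReal_measureReal]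
  exact ENNReal.ofReal_le_ofReal hn

theorem isTightMeasureSet_of_tendsto_levyExponent {ν : ℕ → Measure ℚ_[p]}
    [∀ n, IsFiniteMeasure (ν n)] {L : ℚ_[p] → ℂ} {b : ℚ_[p] → ℝ} (hb : Continuous b)
    (hν : ∀ n t, ‖levyExponent (ν n) t‖ ≤ b t)
    (hL : ∀ t, Tendsto (fun n => levyExponent (ν n) t) atTop (𝓝 (L t)))
    (hL₀ : ContinuousAt L 0) : IsTightMeasureSet (Set.range ν) := by
  refine isTightMeasureSet_range_of_tendsto_limsup_measure_norm_gt
    (ENNReal.tendsto_atTop_zero.2 fun ε hε => ?_)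
  obtain ⟨c, hc, hcε⟩ := exists_eventually_measure_outer_le hb hν hL hL₀ hε
  refine ⟨‖c‖⁻¹, fun r hr => limsup_le_of_le (by isBoundedDefault) ?_⟩
  filter_upwards [hcε] with n hn
  refine (measure_mono fun x hx => ?_).trans hn
  have : ‖c‖⁻¹ < ‖x‖ := hr.trans_lt hx
  rwa [inv_lt_iff_one_lt_mul₀' (norm_pos_iff.2 hc), ← norm_mul] at this

theorem tendsto_charFn_of_tendsto {ι : Type*} {l : Filter ι} {μ : ι → FiniteMeasure ℚ_[p]}
    {ν : FiniteMeasure ℚ_[p]} (h : Tendsto μ l (𝓝 ν)) (t : ℚ_[p]) :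
    Tendsto (fun n => charFn (μ n : Measure ℚ_[p]) t) l (𝓝 (charFn (ν : Measure ℚ_[p]) t)) := by
  rw [FiniteMeasure.tendsto_iff_forall_integral_rclike_tendsto ℂ] at h
  exact h (BoundedContinuousFunction.ofNormedAddCommGroup (fun x => chi (t * x))
    (by fun_prop) 1 (by simp))

theorem exists_isCompact_of_tendsto_charFn {μ : ℕ → FiniteMeasure ℚ_[p]} {h : ℚ_[p] → ℂ}
    (hh : ContinuousAt h 0)
    (hμ : ∀ t, Tendsto (fun n => charFn (μ n : Measure ℚ_[p]) t) atTop (𝓝 (h t))) :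
    ∃ T : Set (FiniteMeasure ℚ_[p]), IsCompact T ∧ ∀ n, μ n ∈ T := by
  have hmass : Tendsto (fun n => (μ n : Measure ℚ_[p]).real Set.univ) atTop (𝓝 ‖h 0‖) := by
    simpa [charFn_zero_eq] using (hμ 0).norm
  obtain ⟨C, hC⟩ := hmass.bddAbove_range
  rw [mem_upperBounds, Set.forall_mem_range] at hC
  have hbound : ∀ n t, ‖levyExponent (μ n : Measure ℚ_[p]) t‖ ≤ C + C := fun n t => by
    rw [levyExponent_eq_charFn_sub, ← charFn_zero_eq]
    exact norm_sub_le_of_le ((norm_charFn_le _ _).trans (hC n)) ((norm_charFn_le _ _).trans (hC n))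
  have hlim : ∀ t, Tendsto (fun n => levyExponent (μ n : Measure ℚ_[p]) t) atTop
      (𝓝 (h t - h 0)) := fun t => by
    simpa only [levyExponent_eq_charFn_sub, ← charFn_zero_eq] using (hμ t).sub (hμ 0)
  have htight := isTightMeasureSet_of_tendsto_levyExponent continuous_const hbound hlim
    (hh.sub continuousAt_const)
  obtain ⟨T, hT, hμT⟩ := exists_isCompact_of_isTightMeasureSet (S := Set.range μ)
    (C := C.toNNReal) (Set.forall_mem_range.2 fun n => NNReal.le_toNNReal_of_coe_le (hC n))
    (by rwa [← Set.range_comp])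
  exact ⟨T, hT, fun n => hμT ⟨n, rfl⟩⟩

theorem exists_tendsto_of_tendsto_charFn {μ : ℕ → FiniteMeasure ℚ_[p]} {h : ℚ_[p] → ℂ}
    (hh : ContinuousAt h 0)
    (hμ : ∀ t, Tendsto (fun n => charFn (μ n : Measure ℚ_[p]) t) atTop (𝓝 (h t))) :
    ∃ ν : FiniteMeasure ℚ_[p], Tendsto μ atTop (𝓝 ν) ∧
      ∀ t, charFn (ν : Measure ℚ_[p]) t = h t := by
  obtain ⟨T, hT, hμT⟩ := exists_isCompact_of_tendsto_charFn hh hμ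
  have hcluster : ∀ ν, MapClusterPt ν atTop μ → ∀ t, charFn (ν : Measure ℚ_[p]) t = h t := by
    intro ν hν t
    obtain ⟨U, hU, hUν⟩ := mapClusterPt_iff_ultrafilter.1 hν
    exact tendsto_nhds_unique (tendsto_charFn_of_tendsto hUν t) ((hμ t).mono_left hU)
  obtain ⟨ν, -, hν⟩ := hT.exists_mapClusterPt (f := atTop) (u := μ)
    (tendsto_principal.2 (.of_forall hμT))
  refine ⟨ν, hT.tendsto_nhds_of_unique_mapClusterPt (.of_forall hμT) fun ν' _ hν' => ?_,
    hcluster ν hν⟩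
  exact FiniteMeasure.toMeasure_injective
    (ext_of_charFn fun t => by rw [hcluster ν' hν', hcluster ν hν])

theorem exists_tendsto_probabilityMeasure_of_tendsto_charFn {μ : ℕ → ProbabilityMeasure ℚ_[p]}
    {h : ℚ_[p] → ℂ} (hh : ContinuousAt h 0)
    (hμ : ∀ t, Tendsto (fun n => charFn (μ n : Measure ℚ_[p]) t) atTop (𝓝 (h t))) :
    ∃ ν : ProbabilityMeasure ℚ_[p], Tendsto μ atTop (𝓝 ν) ∧
      ∀ t, charFn (ν : Measure ℚ_[p]) t = h t := by
  obtain ⟨ν, hν, hνh⟩ := exists_tendsto_of_tendsto_charFn (μ := fun n => (μ n).toFiniteMeasure)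
    hh hμ
  have hmass : ν.mass = 1 := tendsto_nhds_unique hν.mass (by simp)
  have : IsProbabilityMeasure (ν : Measure ℚ_[p]) := ⟨by
    rw [← FiniteMeasure.ennreal_mass, hmass, ENNReal.coe_one]⟩
  exact ⟨⟨ν, this⟩, (ProbabilityMeasure.tendsto_nhds_iff_toFiniteMeasure_tendsto_nhds _).2 hν, hνh⟩

theorem tendsto_of_tendsto_charFn {μ : ℕ → ProbabilityMeasure ℚ_[p]} {ν : ProbabilityMeasure ℚ_[p]}
    (h : ∀ t, Tendsto (fun n => charFn (μ n : Measure ℚ_[p]) t) atTop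
      (𝓝 (charFn (ν : Measure ℚ_[p]) t))) : Tendsto μ atTop (𝓝 ν) := by
  obtain ⟨ν', hμ, hν⟩ := exists_tendsto_probabilityMeasure_of_tendsto_charFn
    (continuous_charFn (ν : Measure ℚ_[p])).continuousAt h
  rwa [ProbabilityMeasure.toMeasure_injective (ext_of_charFn hν)] at hμ

end Continuity

/-! ### Normalized sums -/

section NormalizedSum

variable {p : ℕ} [Fact p.Prime]

theorem chi_mul_sum {ι : Type*} (t : ℚ_[p]) (s : Finset ι) (x : ι → ℚ_[p]) :
    chi (t * ∑ i ∈ s, x i) = ∏ i ∈ s, chi (t * x i) := by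
  classical
  induction s using Finset.induction_on with
  | empty => simp
  | insert i s hi ih => rw [Finset.sum_insert hi, Finset.prod_insert hi, mul_add, chi_add, ih]

variable [MeasurableSpace ℚ_[p]]

theorem isIID_eval (μ : Measure ℚ_[p]) [IsProbabilityMeasure μ] :
    IsIID (Measure.infinitePi fun _ : ℕ => μ) (fun i ω => ω i) where
  measurable := measurable_pi_apply
  indep := iIndepFun_infinitePi (X := fun _ x => x) fun _ => measurable_id
  ident i j := ⟨(measurable_pi_apply i).aemeasurable, (measurable_pi_apply j).aemeasurable, by
    rw [Measure.infinitePi_map_eval, Measure.infinitePi_map_eval]⟩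

variable {Ω : Type*} [MeasurableSpace Ω] {P : Measure Ω} {X : ℕ → Ω → ℚ_[p]}

theorem IsIID.isProbabilityMeasure_map [IsProbabilityMeasure P] (hX : IsIID P X) (i : ℕ) :
    IsProbabilityMeasure (P.map (X i)) :=
  Measure.isProbabilityMeasure_map (hX.measurable i).aemeasurable

variable [BorelSpace ℚ_[p]] {B : ℕ → ℚ_[p]} {k : ℕ → ℕ}

theorem measurable_normalizedSum (hX : ∀ i, Measurable (X i)) (B : ℕ → ℚ_[p]) (k : ℕ → ℕ)
    (n : ℕ) : Measurable (normalizedSum X B k n) := by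
  unfold normalizedSum
  fun_prop

theorem charFn_map_normalizedSum (hX : IsIID P X) (B : ℕ → ℚ_[p]) (k : ℕ → ℕ) (n : ℕ)
    (t : ℚ_[p]) :
    charFn (P.map (normalizedSum X B k n)) t = charFn (P.map (X 0)) (t * (B n)⁻¹) ^ k n := by
  have hm := hX.measurable
  have hindep : iIndepFun (fun i : Fin (k n) => X i) P := hX.indep.precomp Fin.val_injective
  have hprod := hindep.integral_fun_prod_comp (𝕜 := ℂ) (f := fun _ x => chi (t * (B n)⁻¹ * x))
    (fun i => (hm i).aemeasurable) (fun i => Measurable.aestronglyMeasurable (by fun_prop))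
  have hident : ∀ i, ∫ ω, chi (t * (B n)⁻¹ * X i ω) ∂P
      = charFn (P.map (X 0)) (t * (B n)⁻¹) := fun i => by
    rw [← (hX.ident i 0).map_eq, charFn, integral_map (hm i).aemeasurable
      (Measurable.aestronglyMeasurable (by fun_prop))]
  rw [charFn, integral_map (measurable_normalizedSum hm B k n).aemeasurable
    (Measurable.aestronglyMeasurable (by fun_prop))]
  simp only [normalizedSum, ← mul_assoc, chi_mul_sum, Finset.prod_range, hprod, hident,
    Finset.prod_const, Finset.card_univ, Fintype.card_fin]

variable [IsProbabilityMeasure P] {G : Measure ℚ_[p]} [IsProbabilityMeasure G]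

theorem sumsConvergeTo_of_tendsto_charFn (hX : ∀ i, Measurable (X i))
    (h : ∀ t, Tendsto (fun n => charFn (P.map (normalizedSum X B k n)) t) atTop
      (𝓝 (charFn G t))) : SumsConvergeTo P X B k G where
  forall_aemeasurable n := (measurable_normalizedSum hX B k n).aemeasurable
  aemeasurable_limit := aemeasurable_id
  tendsto := tendsto_of_tendsto_charFn (by simpa using h)

end NormalizedSum

/-! ### Infinitely divisible distributions as limits of normalized sums -/

section Existence

theorem apply_mul_pow_of_forall_apply_mul {M N : Type*} [Monoid M] [Monoid N] {f : M → N} {c : M}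
    {b : N} (h : ∀ t, f (t * c) = b * f t) (t : M) (n : ℕ) : f (t * c ^ n) = b ^ n * f t := by
  simpa using (Function.Semiconj.iterate_right (ga := (· * c)) (gb := (b * ·)) h n).eq t

theorem exists_strictMono_tendsto_mul_pow {β : ℝ} (hβ₀ : 0 < β) (hβ₁ : β < 1) :
    ∃ k : ℕ → ℕ, StrictMono k ∧ (∀ n, 0 < k n) ∧
      Tendsto (fun n => (k n : ℝ) * β ^ n) atTop (𝓝 1) := by
  refine ⟨fun n => ⌈(β ^ n)⁻¹⌉₊ + n, fun m n hmn => add_lt_add_of_le_of_lt ?_ hmn,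
    fun n => Nat.add_pos_left (Nat.ceil_pos.2 (inv_pos.2 (pow_pos hβ₀ n))) n, ?_⟩
  · exact Nat.ceil_mono
      (inv_anti₀ (pow_pos hβ₀ _) (pow_le_pow_of_le_one hβ₀.le hβ₁.le hmn.le))
  · have hceil : Tendsto (fun n : ℕ => (⌈(β ^ n)⁻¹⌉₊ : ℝ) / (β ^ n)⁻¹) atTop (𝓝 1) := by
      refine tendsto_nat_ceil_div_atTop.comp ?_
      simp only [← inv_pow]
      exact tendsto_pow_atTop_atTop_of_one_lt ((one_lt_inv₀ hβ₀).2 hβ₁)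
    simpa [add_mul] using hceil.add (tendsto_self_mul_const_pow_of_lt_one hβ₀.le hβ₁)

theorem tendsto_div_succ_of_tendsto_mul_pow {u : ℕ → ℝ} {β a : ℝ} (hβ : β ≠ 0) (ha : a ≠ 0)
    (h : Tendsto (fun n => u n * β ^ n) atTop (𝓝 a)) :
    Tendsto (fun n => u n / u (n + 1)) atTop (𝓝 β) := by
  have hratio := (h.div (h.comp (tendsto_add_atTop_nat 1)) ha).mul_const β
  rw [div_self ha, one_mul] at hratio
  refine hratio.congr fun n => ?_
  simp only [Pi.div_apply, Function.comp_apply, pow_succ]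
  field_simp

variable {p : ℕ} [Fact p.Prime] [MeasurableSpace ℚ_[p]] [BorelSpace ℚ_[p]]

theorem exists_charFn_eq_pow (μ : Measure ℚ_[p]) [IsProbabilityMeasure μ] (m : ℕ) :
    ∃ ν : ProbabilityMeasure ℚ_[p], ∀ t, charFn (ν : Measure ℚ_[p]) t = charFn μ t ^ m := by
  have hX := isIID_eval μ
  refine ⟨⟨(Measure.infinitePi fun _ => μ).map (normalizedSum (fun i ω => ω i) 1 (fun _ => m) 0),
    Measure.isProbabilityMeasure_map
      (measurable_normalizedSum hX.measurable 1 (fun _ => m) 0).aemeasurable⟩, fun t => ?_⟩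
  simp [charFn_map_normalizedSum hX, Measure.infinitePi_map_eval]

theorem exists_charFn_eq_one_add_div (ν : Measure ℚ_[p]) [IsFiniteMeasure ν] {a : ℝ} (ha : 0 < a)
    (hνa : ν.real Set.univ ≤ a) :
    ∃ μ : ProbabilityMeasure ℚ_[p],
      ∀ t, charFn (μ : Measure ℚ_[p]) t = 1 + levyExponent ν t / a := by
  let μ : Measure ℚ_[p] := ENNReal.ofReal (1 - ν.real Set.univ / a) • Measure.dirac 0 +
    ENNReal.ofReal a⁻¹ • ν
  have hfin : IsFiniteMeasure μ :=
    have := (Measure.dirac (0 : ℚ_[p])).smul_finite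
      (ENNReal.ofReal_ne_top (r := 1 - ν.real Set.univ / a))
    have := ν.smul_finite (ENNReal.ofReal_ne_top (r := a⁻¹))
    inferInstance
  have hμ : ∀ t, charFn μ t = 1 + levyExponent ν t / a := fun t => by
    have hweight : 0 ≤ 1 - ν.real Set.univ / a := sub_nonneg.2 ((div_le_one ha).2 hνa)
    rw [charFn, integral_add_measure ((integrable_chi_mul _ t).smul_measure ENNReal.ofReal_ne_top)
      ((integrable_chi_mul _ t).smul_measure ENNReal.ofReal_ne_top), integral_smul_measure,
      integral_smul_measure, integral_dirac, ENNReal.toReal_ofReal hweight,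
      ENNReal.toReal_ofReal (inv_nonneg.2 ha.le), mul_zero, chi_zero, ← charFn,
      levyExponent_eq_charFn_sub, Complex.real_smul, Complex.real_smul]
    push_cast
    ring
  have hmass : μ.real Set.univ = 1 := by
    have := hμ 0
    rw [levyExponent_eq_charFn_sub, ← charFn_zero_eq, sub_self, zero_div, add_zero,
      charFn_zero_eq] at this
    exact_mod_cast this
  exact ⟨⟨μ, ⟨by rw [← ofReal_measureReal, hmass, ENNReal.ofReal_one]⟩⟩, hμ⟩

theorem IsLevyMeasure.exists_charFn_eq_levyExp {Φ : Measure ℚ_[p]} (hΦ : IsLevyMeasure Φ) :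
    ∃ G : ProbabilityMeasure ℚ_[p], ∀ t, charFn (G : Measure ℚ_[p]) t = levyExp Φ t := by
  let ν : ℕ → Measure ℚ_[p] := fun n => Φ.restrict (outer ((p : ℚ_[p]) ^ n)⁻¹)
  have hν : ∀ n, IsFiniteMeasure (ν n) := fun n => hΦ.isFiniteMeasure_restrict_outer _
  let k : ℕ → ℕ := fun n => ⌈(ν n).real Set.univ⌉₊ + n + 1
  have hk : Tendsto k atTop atTop :=
    tendsto_atTop_mono (fun n => (n.le_add_left _).trans (Nat.le_succ _)) tendsto_id
  have hνk : ∀ n, (ν n).real Set.univ ≤ k n := fun n =>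
    (Nat.le_ceil _).trans (Nat.cast_le.2 ((Nat.le_add_right _ n).trans (Nat.le_succ _)))
  have hk₀ : ∀ n, (0 : ℝ) < k n := fun n => Nat.cast_pos.2 (Nat.succ_pos _)
  choose μ hμ using fun n => exists_charFn_eq_one_add_div (ν n) (hk₀ n) (hνk n)
  choose F hF using fun n => exists_charFn_eq_pow (μ n : Measure ℚ_[p]) (k n)
  have hlim : ∀ t, Tendsto (fun n => charFn (F n : Measure ℚ_[p]) t) atTop (𝓝 (levyExp Φ t)) := by
    intro t
    rw [levyExp_eq_exp_levyExponent]
    refine ((Complex.tendsto_one_add_div_pow_exp (levyExponent Φ t)).comp hk).congr' ?_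
    filter_upwards [eventually_norm_le_norm_inv_pow t] with n hn
    simp only [Function.comp_apply, hF, hμ, ν, levyExponent_restrict_outer Φ hn,
      Complex.ofReal_natCast]
  have hcont : Continuous (levyExp Φ) := by
    simpa only [funext (levyExp_eq_exp_levyExponent Φ)] using hΦ.continuous_levyExponent.cexp
  obtain ⟨G, -, hG⟩ :=
    exists_tendsto_probabilityMeasure_of_tendsto_charFn hcont.continuousAt hlim
  exact ⟨G, hG⟩

theorem ScalingRelation.sumsConvergeTo {Ω : Type*} [MeasurableSpace Ω] {P : Measure Ω}
    [IsProbabilityMeasure P] {X : ℕ → Ω → ℚ_[p]} (hX : IsIID P X) {Φ G : Measure ℚ_[p]}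
    [IsProbabilityMeasure G] (hXG : P.map (X 0) = G) (hΦ : IsLevyMeasure Φ)
    (hG : ∀ t, charFn G t = levyExp Φ t) {β : ℝ} (hβ : 0 ≤ β) {γ : ℚ_[p]} (hγ : γ ≠ 0)
    (h : ScalingRelation Φ β γ) {k : ℕ → ℕ}
    (hk : Tendsto (fun n => (k n : ℝ) * β ^ n) atTop (𝓝 1)) :
    SumsConvergeTo P X (fun n => (γ ^ n)⁻¹) k G := by
  refine sumsConvergeTo_of_tendsto_charFn hX.measurable fun t => ?_
  have hpow := apply_mul_pow_of_forall_apply_mul ((scalingRelation_iff_levyExponent hΦ hβ hγ).1 h) t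
  have hlim : Tendsto (fun n => (((k n : ℝ) * β ^ n : ℝ) : ℂ) * levyExponent Φ t) atTop
      (𝓝 (levyExponent Φ t)) := by
    simpa using ((Complex.continuous_ofReal.tendsto _).comp hk).mul_const (levyExponent Φ t)
  simp only [charFn_map_normalizedSum hX, hXG, hG, levyExp_eq_exp_levyExponent, inv_inv, hpow,
    ← Complex.exp_nat_mul]
  refine hlim.cexp.congr fun n => ?_
  push_cast
  rw [mul_assoc]

end Existence

/-! ### Lévy exponents as limits -/

theorem exists_measure_restrict_eq {α : Type*} [MeasurableSpace α] {s : ℕ → Set α}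
    (hs : ∀ n, MeasurableSet (s n)) {ν : ℕ → Measure α}
    (h : ∀ m n, (ν m).restrict (s m ∩ s n) = (ν n).restrict (s m ∩ s n)) :
    ∃ μ : Measure α, μ (⋃ n, s n)ᶜ = 0 ∧ ∀ n, μ.restrict (s n) = (ν n).restrict (s n) := by
  have hd : ∀ n, MeasurableSet (disjointed s n) := fun n => .disjointed hs n
  refine ⟨Measure.sum fun n => (ν n).restrict (disjointed s n), ?_, fun n => ?_⟩
  · rw [Measure.sum_apply_eq_zero]
    refine fun n => (Measure.restrict_apply_eq_zero' (hd n)).2 ?_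
    rw [((Set.disjoint_compl_left_iff_subset.2
      ((disjointed_subset s n).trans (Set.subset_iUnion s n)))).inter_eq, measure_empty]
  have hpiece : ∀ m, ((ν m).restrict (disjointed s m)).restrict (s n)
      = (ν n).restrict (disjointed s m ∩ s n) := fun m => by
    have hsub : disjointed s m ∩ s n ⊆ s m ∩ s n :=
      Set.inter_subset_inter_left _ (disjointed_subset s m)
    rw [Measure.restrict_restrict (hs n), Set.inter_comm,
      ← Measure.restrict_restrict_of_subset hsub, h m n, Measure.restrict_restrict_of_subset hsub]
  rw [Measure.restrict_sum _ (hs n)]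
  simp only [hpiece]
  rw [← Measure.restrict_iUnion, ← Set.iUnion_inter, iUnion_disjointed,
    Set.inter_eq_right.2 (Set.subset_iUnion s n)]
  · exact fun i j hij => ((disjoint_disjointed s) hij).mono Set.inter_subset_left
      Set.inter_subset_left
  · exact fun m => (hd m).inter (hs n)

section LevyLimit

variable {p : ℕ} [Fact p.Prime] [MeasurableSpace ℚ_[p]] [BorelSpace ℚ_[p]]

theorem restrict_outer_eq_of_charFn_eq_ballDeviation {L : ℚ_[p] → ℂ} (hL : Continuous L)
    {c d : ℚ_[p]} (hcd : ‖c‖ ≤ ‖d‖) {μ ν : Measure ℚ_[p]} [IsFiniteMeasure μ] [IsFiniteMeasure ν]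
    (hμ : ∀ s, charFn μ s = ballDeviation L c s) (hν : ∀ s, charFn ν s = ballDeviation L d s) :
    ν.restrict (outer c) = μ.restrict (outer c) := by
  refine ext_of_charFn fun s => ?_
  rw [charFn_restrict_outer, charFn_restrict_outer, funext hμ, funext hν,
    ballDeviation_ballDeviation hL hcd, ballDeviation_ballDeviation hL le_rfl]

theorem exists_isLevyMeasure_of_charFn_eq_ballDeviation {L : ℚ_[p] → ℂ} (hL : Continuous L)
    (hL₀ : L 0 = 0) {κ : ℚ_[p] → Measure ℚ_[p]} [∀ c, IsFiniteMeasure (κ c)]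
    (hκ : ∀ c s, charFn (κ c) s = ballDeviation L c s) :
    ∃ Φ : Measure ℚ_[p], IsLevyMeasure Φ ∧ ∀ t, levyExponent Φ t = L t := by
  have hcompat : ∀ {c d : ℚ_[p]}, ‖c‖ ≤ ‖d‖ →
      (κ d).restrict (outer c) = (κ c).restrict (outer c) := fun hcd =>
    restrict_outer_eq_of_charFn_eq_ballDeviation hL hcd (hκ _) (hκ _)
  let c : ℕ → ℚ_[p] := fun n => ((p : ℚ_[p]) ^ n)⁻¹
  obtain ⟨Φ, hΦ₀, hΦ⟩ := exists_measure_restrict_eq (fun n => measurableSet_outer (c n))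
    (ν := fun n => κ (c n)) fun m n => by
      rcases le_total ‖c m‖ ‖c n‖ with h | h
      · rw [Set.inter_eq_left.2 (outer_subset_outer h), hcompat h]
      · rw [Set.inter_eq_right.2 (outer_subset_outer h), hcompat h]
  rw [iUnion_outer_inv_pow, compl_compl] at hΦ₀
  have hΦκ : ∀ d, Φ.restrict (outer d) = (κ d).restrict (outer d) := fun d => by
    obtain ⟨n, hn⟩ := (eventually_norm_le_norm_inv_pow d).exists
    rw [← Measure.restrict_restrict_of_subset (outer_subset_outer hn), hΦ,
      Measure.restrict_restrict_of_subset (outer_subset_outer hn), hcompat hn]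
  refine ⟨Φ, isLevyMeasure_of_outer_lt_top hΦ₀ fun d => ?_, fun t => ?_⟩
  · rw [← Measure.restrict_apply_self, hΦκ]
    exact measure_lt_top _ _
  · rw [← levyExponent_restrict_outer Φ le_rfl, hΦκ, levyExponent_restrict_outer _ le_rfl,
      levyExponent_eq_charFn_sub, ← charFn_zero_eq, hκ, hκ]
    have := ballDeviation_sub_ballDeviation hL (le_refl ‖t‖) 0
    rw [zero_add, hL₀, zero_sub] at this
    rw [← neg_sub, this, neg_neg]

theorem exists_isLevyMeasure_of_tendsto_levyExponent {ν : ℕ → Measure ℚ_[p]}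
    [∀ n, IsFiniteMeasure (ν n)] {L : ℚ_[p] → ℂ} {b : ℚ_[p] → ℝ} (hb : Continuous b)
    (hν : ∀ n t, ‖levyExponent (ν n) t‖ ≤ b t)
    (hL : ∀ t, Tendsto (fun n => levyExponent (ν n) t) atTop (𝓝 (L t))) (hLc : Continuous L) :
    ∃ Φ : Measure ℚ_[p], IsLevyMeasure Φ ∧ ∀ t, levyExponent Φ t = L t := by
  have hL₀ : L 0 = 0 := tendsto_nhds_unique (hL 0) (by simp [levyExponent])
  have hκ : ∀ c, ∃ κ : FiniteMeasure ℚ_[p],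
      ∀ s, charFn (κ : Measure ℚ_[p]) s = ballDeviation L c s := fun c => by
    obtain ⟨κ, -, hκ⟩ := exists_tendsto_of_tendsto_charFn
      (μ := fun n => ⟨(ν n).restrict (outer c), inferInstance⟩)
      (continuous_ballDeviation hLc c).continuousAt (tendsto_charFn_restrict_outer hb hν hL c)
    exact ⟨κ, hκ⟩
  choose κ hκ using hκ
  exact exists_isLevyMeasure_of_charFn_eq_ballDeviation hLc hL₀ hκ

end LevyLimit

theorem inv_mul_one_sub_exp_neg_mul_mem_Icc {x a : ℝ} (hx : 0 < x) (ha : 0 ≤ a) :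
    x⁻¹ * (1 - Real.exp (-(x * a))) ∈ Set.Icc 0 a := by
  have : Real.exp (-(x * a)) ≤ 1 := Real.exp_le_one_iff.2 (neg_nonpos.2 (by positivity))
  refine ⟨mul_nonneg (inv_nonneg.2 hx.le) (sub_nonneg.2 this), ?_⟩
  rw [inv_mul_le_iff₀ hx]
  linarith [Real.add_one_le_exp (-(x * a))]

theorem tendsto_inv_mul_one_sub_exp_neg_mul (a : ℝ) :
    Tendsto (fun x : ℝ => x⁻¹ * (1 - Real.exp (-(x * a)))) (𝓝[≠] 0) (𝓝 a) := by
  have hd : HasDerivAt (fun x : ℝ => 1 - Real.exp (-(x * a))) a 0 := by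
    simpa using (((hasDerivAt_id (0 : ℝ)).mul_const a).neg.exp).const_sub 1
  simpa using hasDerivAt_iff_tendsto_slope_zero.1 hd

section Exponent

variable {p : ℕ} [Fact p.Prime] [MeasurableSpace ℚ_[p]] [BorelSpace ℚ_[p]]

theorem exists_isLevyMeasure_of_charFn_eq_exp_neg {G : Measure ℚ_[p]} [IsProbabilityMeasure G]
    {ψ : ℚ_[p] → ℝ} (hψc : Continuous ψ) (hψ₀ : ∀ t, 0 ≤ ψ t)
    (hG : ∀ t, charFn G t = Real.exp (-ψ t)) {β : ℝ} (hβ₀ : 0 < β) (hβ₁ : β < 1) {γ : ℚ_[p]}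
    (hψ : ∀ t, ψ (t * γ) = β * ψ t) :
    ∃ Φ : Measure ℚ_[p], IsLevyMeasure Φ ∧ ∀ t, levyExponent Φ t = -(ψ t : ℂ) := by
  let ν : ℕ → Measure ℚ_[p] := fun n => ENNReal.ofReal (β ^ n)⁻¹ • G.map (γ ^ n * ·)
  have hexp : ∀ n t, levyExponent (ν n) t
      = -(((β ^ n)⁻¹ * (1 - Real.exp (-(β ^ n * ψ t))) : ℝ) : ℂ) := fun n t => by
    simp only [ν]
    rw [levyExponent_ofReal_smul _ (by positivity), levyExponent_map_const_mul,
      levyExponent_eq_charFn_sub, hG, apply_mul_pow_of_forall_apply_mul hψ, probReal_univ]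
    push_cast
    ring
  have hfin : ∀ n, IsFiniteMeasure (ν n) := fun n => by
    have := Measure.isFiniteMeasure_map G (γ ^ n * ·)
    exact Measure.smul_finite _ ENNReal.ofReal_ne_top
  refine exists_isLevyMeasure_of_tendsto_levyExponent hψc (ν := ν) (fun n t => ?_) (fun t => ?_)
    (by fun_prop)
  · have := inv_mul_one_sub_exp_neg_mul_mem_Icc (pow_pos hβ₀ n) (hψ₀ t)
    rw [hexp, norm_neg, Complex.norm_real, Real.norm_of_nonneg this.1]
    exact this.2
  · have hpow : Tendsto (fun n : ℕ => β ^ n) atTop (𝓝[≠] 0) := tendsto_nhdsWithin_iff.2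
      ⟨tendsto_pow_atTop_nhds_zero_of_lt_one hβ₀.le hβ₁, .of_forall fun n => (pow_pos hβ₀ n).ne'⟩
    simp only [hexp]
    exact ((Complex.continuous_ofReal.tendsto _).comp
      ((tendsto_inv_mul_one_sub_exp_neg_mul (ψ t)).comp hpow)).neg

end Exponent

/-! ### Symmetric sums -/

section SymmetricSum

theorem eq_rpow_of_tendsto_pow {a : ℕ → ℝ} (ha : ∀ᶠ n in atTop, 0 ≤ a n) {k m : ℕ → ℕ}
    (hm : ∀ n, m n ≠ 0) {x y r : ℝ} (hx : Tendsto (fun n => a n ^ m n) atTop (𝓝 x))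
    (hy : Tendsto (fun n => a n ^ k n) atTop (𝓝 y)) (hr : 0 < r)
    (hkm : Tendsto (fun n => (k n : ℝ) / m n) atTop (𝓝 r)) : y = x ^ r := by
  refine tendsto_nhds_unique hy ((hx.rpow hkm (.inr hr)).congr' ?_)
  filter_upwards [ha] with n hn
  rw [← Real.rpow_natCast, ← Real.rpow_mul hn, mul_div_cancel₀ _ (Nat.cast_ne_zero.2 (hm n)),
    Real.rpow_natCast]

theorem pos_of_apply_mul_eq_rpow {R : Type*} [NormedRing R] {g : R → ℝ} (hg : ContinuousAt g 0)
    (hg₀ : g 0 ≠ 0) (hnn : ∀ t, 0 ≤ g t) {γ : R} (hγ : ‖γ‖ < 1) {β : ℝ} (hβ : β ≠ 0)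
    (h : ∀ t, g (t * γ) = g t ^ β) (t : R) : 0 < g t := by
  refine (hnn t).lt_of_ne' fun ht => hg₀ ?_
  have hzero : ∀ n : ℕ, g (t * γ ^ n) = 0 := fun n => by
    induction n with
    | zero => simpa using ht
    | succ n ih => rw [pow_succ, ← mul_assoc, h, ih, Real.zero_rpow hβ]
  have hpow : Tendsto (fun n : ℕ => t * γ ^ n) atTop (𝓝 0) := by
    simpa using (tendsto_pow_atTop_nhds_zero_of_norm_lt_one hγ).const_mul t
  exact tendsto_nhds_unique (hg.tendsto.comp hpow) (by simp [Function.comp_def, hzero])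

variable {p : ℕ} [Fact p.Prime] [MeasurableSpace ℚ_[p]] [BorelSpace ℚ_[p]]

theorem IsSymm.ofReal_re_charFn {μ : Measure ℚ_[p]} (h : IsSymm μ) (t : ℚ_[p]) :
    ((charFn μ t).re : ℂ) = charFn μ t :=
  Complex.conj_eq_iff_re.1 (h.conj_charFn t)

theorem eventually_re_charFn_pos (μ : Measure ℚ_[p]) [IsProbabilityMeasure μ] {B : ℕ → ℚ_[p]}
    (hB : Tendsto (fun n => ‖B n‖) atTop atTop) (t : ℚ_[p]) :
    ∀ᶠ n in atTop, 0 < (charFn μ (t * (B n)⁻¹)).re := by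
  have hinv : Tendsto (fun n => t * (B n)⁻¹) atTop (𝓝 0) := by
    simpa using (Filter.tendsto_inv₀_cobounded.comp
      (tendsto_norm_atTop_iff_cobounded.1 hB)).const_mul t
  have hcont : Continuous fun t => (charFn μ t).re :=
    Complex.continuous_re.comp (continuous_charFn μ)
  exact hinv.eventually (hcont.continuousAt.eventually_const_lt (by simp [charFn_zero_eq]))

variable {Ω : Type*} [MeasurableSpace Ω] {P : Measure Ω} [IsProbabilityMeasure P]
  {X : ℕ → Ω → ℚ_[p]} {B : ℕ → ℚ_[p]} {k : ℕ → ℕ} {G : Measure ℚ_[p]} [IsProbabilityMeasure G]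

theorem SumsConvergeTo.tendsto_charFn_mul (h : SumsConvergeTo P X B k G) {c : ℕ → ℚ_[p]}
    {c₀ : ℚ_[p]} (hc : Tendsto c atTop (𝓝 c₀)) (t : ℚ_[p]) :
    Tendsto (fun n => charFn (P.map (normalizedSum X B k n)) (t * c n)) atTop
      (𝓝 (charFn G (t * c₀))) := by
  have hcm : TendstoInMeasure P (fun n (_ : Ω) => c n) atTop (fun _ => c₀) :=
    tendstoInMeasure_of_tendsto_ae (fun n => aestronglyMeasurable_const) (.of_forall fun _ => hc)
  have hprod := TendstoInDistribution.continuous_comp_prodMk_of_tendstoInMeasure_const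
    (g := fun z : ℚ_[p] × ℚ_[p] => z.2 * z.1) (by fun_prop) h hcm (fun n => aemeasurable_const)
  have hlim := tendsto_charFn_of_tendsto
    ((ProbabilityMeasure.tendsto_nhds_iff_toFiniteMeasure_tendsto_nhds _).1 hprod.tendsto) t
  rw [← charFn_map_const_mul]
  refine hlim.congr fun n => ?_
  rw [← charFn_map_const_mul, AEMeasurable.map_map_of_aemeasurable (by fun_prop)
    (h.forall_aemeasurable n)]
  rfl

theorem SumsConvergeTo.tendsto_re_charFn_pow (h : SumsConvergeTo P X B k G) (hX : IsIID P X)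
    (hsymm : IsSymm (P.map (X 0))) (hB : ∀ n, B n ≠ 0) {b : ℕ → ℚ_[p]} {c : ℚ_[p]}
    (hb : Tendsto (fun n => B n / b n) atTop (𝓝 c)) (t : ℚ_[p]) :
    Tendsto (fun n => (((charFn (P.map (X 0)) (t * (b n)⁻¹)).re ^ k n : ℝ) : ℂ)) atTop
      (𝓝 (charFn G (t * c))) := by
  refine (h.tendsto_charFn_mul hb t).congr fun n => ?_
  rw [charFn_map_normalizedSum hX, mul_assoc, div_eq_inv_mul, mul_inv_cancel_right₀ (hB n),
    Complex.ofReal_pow, hsymm.ofReal_re_charFn]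

theorem SumsConvergeTo.tendsto_re_charFn_pow_self (h : SumsConvergeTo P X B k G)
    (hX : IsIID P X) (hsymm : IsSymm (P.map (X 0))) (hB : ∀ n, B n ≠ 0) (t : ℚ_[p]) :
    Tendsto (fun n => (((charFn (P.map (X 0)) (t * (B n)⁻¹)).re ^ k n : ℝ) : ℂ)) atTop
      (𝓝 (charFn G t)) := by
  have hlim := h.tendsto_re_charFn_pow hX hsymm hB
    (tendsto_const_nhds.congr fun n => (div_self (hB n)).symm) t
  rwa [mul_one] at hlim

theorem SumsConvergeTo.ofReal_re_charFn (h : SumsConvergeTo P X B k G) (hX : IsIID P X)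
    (hsymm : IsSymm (P.map (X 0))) (hB : ∀ n, B n ≠ 0) (t : ℚ_[p]) :
    ((charFn G t).re : ℂ) = charFn G t :=
  have hlim := h.tendsto_re_charFn_pow_self hX hsymm hB t
  tendsto_nhds_unique ((Complex.continuous_ofReal.tendsto _).comp
    ((Complex.continuous_re.tendsto _).comp hlim)) hlim

theorem SumsConvergeTo.re_charFn_nonneg (h : SumsConvergeTo P X B k G) (hX : IsIID P X)
    (hsymm : IsSymm (P.map (X 0))) (hB : ∀ n, B n ≠ 0)
    (hBtop : Tendsto (fun n => ‖B n‖) atTop atTop) (t : ℚ_[p]) : 0 ≤ (charFn G t).re := by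
  have := hX.isProbabilityMeasure_map 0
  refine ge_of_tendsto ((Complex.continuous_re.tendsto _).comp
    (h.tendsto_re_charFn_pow_self hX hsymm hB t)) ?_
  filter_upwards [eventually_re_charFn_pos (P.map (X 0)) hBtop t] with n hn
    using pow_nonneg hn.le (k n)

theorem SumsConvergeTo.re_charFn_mul_eq_rpow (h : SumsConvergeTo P X B k G)
    (hX : IsIID P X) (hsymm : IsSymm (P.map (X 0))) (hB : ∀ n, B n ≠ 0) (hk : ∀ n, 0 < k n)
    (hBtop : Tendsto (fun n => ‖B n‖) atTop atTop) {β : ℝ} (hβ : 0 < β)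
    (hρ : Tendsto (fun n => (k n : ℝ) / (k (n + 1) : ℝ)) atTop (𝓝 β)) {γ : ℚ_[p]}
    (hγ : Tendsto (fun n => B n / B (n + 1)) atTop (𝓝 γ)) (t : ℚ_[p]) :
    (charFn G (t * γ)).re = (charFn G t).re ^ β := by
  have := hX.isProbabilityMeasure_map 0
  have hre {z : ℂ} := Complex.continuous_re.tendsto z
  have hshift := tendsto_add_atTop_nat 1
  have hpos := hshift.eventually (eventually_re_charFn_pos (P.map (X 0)) hBtop t)
  exact eq_rpow_of_tendsto_pow (hpos.mono fun n => le_of_lt) (fun n => (hk (n + 1)).ne')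
    ((hre.comp (h.tendsto_re_charFn_pow_self hX hsymm hB t)).comp hshift)
    (hre.comp (h.tendsto_re_charFn_pow hX hsymm hB hγ t)) hβ hρ

theorem SumsConvergeTo.exists_charFn_eq_exp_neg (h : SumsConvergeTo P X B k G)
    (hX : IsIID P X) (hsymm : IsSymm (P.map (X 0))) (hB : ∀ n, B n ≠ 0) (hk : ∀ n, 0 < k n)
    (hBtop : Tendsto (fun n => ‖B n‖) atTop atTop) {β : ℝ} (hβ : 0 < β)
    (hρ : Tendsto (fun n => (k n : ℝ) / (k (n + 1) : ℝ)) atTop (𝓝 β)) {γ : ℚ_[p]}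
    (hγ₁ : ‖γ‖ < 1) (hγ : Tendsto (fun n => B n / B (n + 1)) atTop (𝓝 γ)) :
    ∃ ψ : ℚ_[p] → ℝ, Continuous ψ ∧ (∀ t, 0 ≤ ψ t) ∧ (∀ t, ψ (t * γ) = β * ψ t) ∧
      ∀ t, charFn G t = Real.exp (-ψ t) := by
  have hfun := h.re_charFn_mul_eq_rpow hX hsymm hB hk hBtop hβ hρ hγ
  have hcont : Continuous fun t => (charFn G t).re :=
    Complex.continuous_re.comp (continuous_charFn G)
  have hpos : ∀ t, 0 < (charFn G t).re := pos_of_apply_mul_eq_rpow hcont.continuousAt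
    (by simp [charFn_zero_eq]) (h.re_charFn_nonneg hX hsymm hB hBtop) hγ₁ hβ.ne' hfun
  refine ⟨fun t => -Real.log (charFn G t).re, (hcont.log fun t => (hpos t).ne').neg,
    fun t => neg_nonneg.2 (Real.log_nonpos (hpos t).le ?_), fun t => ?_, fun t => ?_⟩
  · simpa using (Complex.re_le_norm (charFn G t)).trans (norm_charFn_le G t)
  · simp only [hfun, Real.log_rpow (hpos t), mul_neg]
  · rw [neg_neg, Real.exp_log (hpos t), h.ofReal_re_charFn hX hsymm hB]

end SymmetricSum

end PadicLimit

end

theorem theorem1 {p : ℕ} [Fact p.Prime] [MeasurableSpace ℚ_[p]] [BorelSpace ℚ_[p]]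
    (β : ℝ) (hβ₀ : 0 < β) (hβ₁ : β < 1)
    (γ₀ : ℚ_[p]) (hγ₀ : γ₀ ≠ 0) (hγ₁ : ‖γ₀‖ ≤ (p : ℝ)⁻¹) :
    (∀ Φ : Measure ℚ_[p], PadicLimit.IsLevyMeasure Φ → PadicLimit.ScalingRelation Φ β γ₀ →
      ∃ (G : Measure ℚ_[p]) (_ : IsProbabilityMeasure G),
        (∀ t, PadicLimit.charFn G t = PadicLimit.levyExp Φ t) ∧
        ∃ (Ω : Type) (_ : MeasurableSpace Ω) (P : Measure Ω) (_ : IsProbabilityMeasure P)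
          (X : ℕ → Ω → ℚ_[p]) (B : ℕ → ℚ_[p]) (k : ℕ → ℕ),
          PadicLimit.IsIID P X ∧ (∀ n, B n ≠ 0) ∧ (∀ n, 0 < k n) ∧ StrictMono k ∧
          Tendsto (fun n => (k n : ℝ) / (k (n + 1) : ℝ)) atTop (𝓝 β) ∧
          Tendsto (fun n => B n / B (n + 1)) atTop (𝓝 γ₀) ∧
          PadicLimit.SumsConvergeTo P X B k G) ∧
    (∀ (Ω : Type*) [MeasurableSpace Ω] (P : Measure Ω) [IsProbabilityMeasure P]
      (X : ℕ → Ω → ℚ_[p]) (B : ℕ → ℚ_[p]) (k : ℕ → ℕ)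
      (G : Measure ℚ_[p]) [IsProbabilityMeasure G],
      PadicLimit.IsIID P X → (∀ i, PadicLimit.IsSymm (P.map (X i))) →
      (∀ n, B n ≠ 0) → (∀ n, 0 < k n) → Monotone k →
      Tendsto (fun n => ‖B n‖) atTop atTop →
      Tendsto (fun n => (k n : ℝ) / (k (n + 1) : ℝ)) atTop (𝓝 β) →
      Tendsto (fun n => B n / B (n + 1)) atTop (𝓝 γ₀) →
      PadicLimit.SumsConvergeTo P X B k G →
      ∃ Φ : Measure ℚ_[p], PadicLimit.IsLevyMeasure Φ ∧ PadicLimit.IsSymm Φ ∧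
        PadicLimit.ScalingRelation Φ β γ₀ ∧
        ∀ t, PadicLimit.charFn G t = PadicLimit.levyExp Φ t) := by
  refine ⟨fun Φ hΦ hs => ?_, ?_⟩
  · obtain ⟨G, hG⟩ := hΦ.exists_charFn_eq_levyExp
    obtain ⟨k, hmono, hpos, hk⟩ := PadicLimit.exists_strictMono_tendsto_mul_pow hβ₀ hβ₁
    have hX := PadicLimit.isIID_eval (G : Measure ℚ_[p])
    refine ⟨G, inferInstance, hG, ℕ → ℚ_[p], inferInstance,
      Measure.infinitePi fun _ => (G : Measure ℚ_[p]), inferInstance, fun i ω => ω i,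
      fun n => (γ₀ ^ n)⁻¹, k, hX, fun n => inv_ne_zero (pow_ne_zero n hγ₀), hpos, hmono,
      PadicLimit.tendsto_div_succ_of_tendsto_mul_pow hβ₀.ne' one_ne_zero hk,
      tendsto_const_nhds.congr fun n => ?_,
      hs.sumsConvergeTo hX (Measure.infinitePi_map_eval _ 0) hΦ hG hβ₀.le hγ₀ hk⟩
    rw [inv_div_inv, pow_succ, mul_div_cancel_left₀ _ (pow_ne_zero n hγ₀)]
  · intro Ω _ P _ X B k G _ hX hsymm hB hk _ hBtop hρ hγ h
    have hγ₁' : ‖γ₀‖ < 1 :=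
      hγ₁.trans_lt (inv_lt_one_of_one_lt₀ (Nat.one_lt_cast.2 (Fact.out : p.Prime).one_lt))
    obtain ⟨ψ, hψc, hψ₀, hψ, hG⟩ :=
      h.exists_charFn_eq_exp_neg hX (hsymm 0) hB hk hBtop hβ₀ hρ hγ₁' hγ
    obtain ⟨Φ, hΦ, hΦψ⟩ :=
      PadicLimit.exists_isLevyMeasure_of_charFn_eq_exp_neg hψc hψ₀ hG hβ₀ hβ₁ hψ
    refine ⟨Φ, hΦ, hΦ.isSymm_of_conj_levyExponent fun t => by simp [hΦψ],
      (PadicLimit.scalingRelation_iff_levyExponent hΦ hβ₀.le hγ₀).2 fun t => ?_, fun t => ?_⟩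
    · rw [hΦψ, hΦψ, hψ, Complex.ofReal_mul, mul_neg]
    · rw [PadicLimit.levyExp_eq_exp_levyExponent, hΦψ, hG, Complex.ofReal_exp, Complex.ofReal_neg]
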